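/- An automorphism of a standard Borel probability space $(X,\mathcal B,\mu)$ is an invertible bi-measurable $\mu$-preserving map $T\colon X\to X$; its Koopman operator is the unitary operator $U_Tf=f\circ T$ on $L^2(X,\mu;\mathbb C)$. For a unitary operator $U$ on a separable Hilbert space $H$ and $x\in H$, the spectral measure $\sigma_x$ is the finite positive Borel measure on $\mathbb T=\{z\in\mathbb C:|z|=1\}$ with $\langle U^mx,x\rangle=\int_{\mathbb T}z^m\,d\sigma_x(z)$ for all $m\in\mathbb Z$, and $\mathbb Z(x)$ is the closed linear span of $\{U^mx:m\in\mathbb Z\}$. The maximal spectral type of $U$ is the class of all finite measures equivalent to $\sigma_{x_1}$ in any orthogonal decomposition $H=\bigoplus_{i\ge 1}\mathbb Z(x_i)$ with $\sigma_{x_1}\gg\sigma_{x_2}\gg\cdots$; the maximal spectral type $\sigma_T$ of $T$ is that of $U_T$. The automorphism $T$ has the property $\mathrm{CS}(n)$ if $\sigma_T\perp\nu_1*\cdots*\nu_n$ for all continuous (i.e. atomless) finite positive Borel measures $\nu_1,\dots,\nu_n$ on $\mathbb T$. An ergodic joining of automorphisms $T$ of $(X,\mu)$ and $S$ of $(Y,\nu)$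 is a $T\times S$-invariant ergodic probability measure on $X\times Y$ with marginals $\mu$ and $\nu$. For $m\ge 1$, an ergodic automorphism $T$ of $(X,\mathcal B,\mu)$ has the joining primeness property $\mathrm{JP}(m)$ if for every $k\ge m+1$, all weakly mixing automorphisms $S_i$ of standard Borel probability spaces $(Y_i,\mathcal C_i,\nu_i)$, $1\le i\le k$, and every ergodic joining $\lambda$ of $T$ and $S_1\times\cdots\times S_k$, there are indices $1\le i_1<\cdots<i_m\le k$ such that $$\lambda=\lambda_{X,Y_{i_1},\dots,Y_{i_m}}\otimes\bigotimes_{j\notin\{i_1,\dots,i_m\}}\nu_j,$$ where $\lambda_{X,Y_{i_1},\dots,Y_{i_m}}$ is the projection of $\lambda$ on $X\times Y_{i_1}\times\cdots\times Y_{i_m}$. Theorem. Let $n\ge 2$ and let $T$ be an ergodic automorphism of a standard Borel probability space $(X,\mathcal B,\mu)$ with the property $\mathrm{CS}(n)$. Then $T$ has the property $\mathrm{JP}(n-1)$. -/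

import Mathlib

open MeasureTheory Filter
open scoped Topology

universe u v

noncomputable section

/-- The circle `{z : ℂ | |z| = 1}` carries its Borel σ-algebra. -/
instance instMeasurableSpaceCircle : MeasurableSpace Circle := borel Circle

instance instBorelSpaceCircle : BorelSpace Circle := ⟨rfl⟩

/-! ### Spectral theory of unitary operators -/

section Spectral

variable {H : Type*} [NormedAddCommGroup H] [InnerProductSpace ℂ H]

/-- `σ` is the spectral measure of `x` with respect to the unitary operator `U`: the finite
positive Borel measure on the circle with `⟨Uⁿ x, x⟩ = ∫ zⁿ dσ` for all `n ∈ ℤ`. (Mathlib's inner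
product is linear in the second variable.) -/
def IsSpectralMeasure (U : H ≃ₗᵢ[ℂ] H) (x : H) (σ : Measure Circle) : Prop :=
  IsFiniteMeasure σ ∧ ∀ n : ℤ, inner ℂ x ((U ^ n) x) = ∫ z : Circle, ((z ^ n : Circle) : ℂ) ∂σ

/-- The cyclic space of `x`: the closed linear span of `Uⁿ x`, `n ∈ ℤ`. -/
def cyclicSpace (U : H ≃ₗᵢ[ℂ] H) (x : H) : Submodule ℂ H :=
  (Submodule.span ℂ (Set.range fun n : ℤ => (U ^ n) x)).topologicalClosure

/-- `σ` is (a representative of) the maximal spectral type of `U`: there is a decomposition of `H`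
into an orthogonal Hilbert sum of cyclic spaces of vectors `x 0, x 1, …` whose spectral measures
`τ 0 ≫ τ 1 ≫ …` decrease with respect to absolute continuity, and `σ` is a finite measure
equivalent to `τ 0`. (Some of the `x i` may be zero.) -/
def IsMaximalSpectralType [CompleteSpace H] (U : H ≃ₗᵢ[ℂ] H) (σ : Measure Circle) : Prop :=
  IsFiniteMeasure σ ∧
  ∃ (x : ℕ → H) (τ : ℕ → Measure Circle),
    IsHilbertSum ℂ (fun i => cyclicSpace U (x i)) (fun i => (cyclicSpace U (x i)).subtypeₗᵢ) ∧
    (∀ i, IsSpectralMeasure U (x i) (τ i)) ∧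
    (∀ i, τ (i + 1) ≪ τ i) ∧
    σ ≪ τ 0 ∧ τ 0 ≪ σ

end Spectral

/-- The convolution `ν₁ ∗ ⋯ ∗ νₙ` of finite measures on the circle: the image of the product measure
under multiplication. -/
def circleConvolution {n : ℕ} (ν : Fin n → Measure Circle) [∀ i, IsFiniteMeasure (ν i)] :
    Measure Circle :=
  (Measure.pi ν).map fun z => ∏ i, z i

/-- Convolution singularity of order `n` for a measure on the circle: singularity with respect to
the convolution of any `n` continuous (that is, atomless) finite measures. -/
def MeasureHasCS (n : ℕ) (σ : Measure Circle) : Prop :=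
  ∀ (ν : Fin n → Measure Circle) [∀ i, IsFiniteMeasure (ν i)] [∀ i, NullSingletonClass (ν i)],
    Measure.MutuallySingular σ (circleConvolution ν)

/-! ### Automorphisms of probability spaces -/

section Dynamics

variable {X : Type*} [MeasurableSpace X]

/-- The Koopman operator `f ↦ f ∘ T` of an automorphism, a unitary operator on `L²(X, μ; ℂ)`. -/
def koopman (μ : Measure X) (T : X ≃ᵐ X) (hT : MeasurePreserving T μ μ) :
    Lp ℂ 2 μ ≃ₗᵢ[ℂ] Lp ℂ 2 μ where
  toFun f := Lp.compMeasurePreserving T hT f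
  invFun f := Lp.compMeasurePreserving T.symm (hT.symm T) f
  map_add' f g := map_add _ f g
  map_smul' c f := (Lp.compMeasurePreservingₗ ℂ T hT).map_smul c f
  left_inv f := by
    beta_reduce
    rw [← Lp.compMeasurePreserving_comp_apply]
    simp
  right_inv f := by
    beta_reduce
    rw [← Lp.compMeasurePreserving_comp_apply]
    simp
  norm_map' f := Lp.norm_compMeasurePreserving f hT

/-- The automorphism `T` has the convolution singularity property of order `n`: its maximal spectral
type, that is, the maximal spectral type of its Koopman operator on `L²(X, μ)`, has it. -/
def HasCS (n : ℕ) (μ : Measure X) (T : X ≃ᵐ X) (hT : MeasurePreserving T μ μ) : Prop :=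
  ∃ σ : Measure Circle, IsMaximalSpectralType (koopman μ T hT) σ ∧ MeasureHasCS n σ

/-- `S` is a weakly mixing automorphism of the probability space `(X, μ)`:
`N⁻¹ ∑_{i < N} |μ (S⁻ⁱ A ∩ B) - μ A * μ B| → 0` for all measurable `A`, `B`. -/
def IsWeaklyMixing (μ : Measure X) (S : X ≃ᵐ X) : Prop :=
  MeasurePreserving S μ μ ∧
  ∀ A B : Set X, MeasurableSet A → MeasurableSet B →
    Tendsto (fun N : ℕ => (N : ℝ)⁻¹ *
      ∑ i ∈ Finset.range N, |μ.real (S^[i] ⁻¹' A ∩ B) - μ.real A * μ.real B|) atTop (𝓝 0)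

/-- `lam` is an ergodic joining of `T` (acting on `(X, μ)`) and `S` (acting on `(Y, ν)`): a measure
on `X × Y` with marginals `μ` and `ν`, invariant and ergodic under `T × S`. -/
def IsErgodicJoining {Y : Type*} [MeasurableSpace Y] (μ : Measure X) (T : X ≃ᵐ X)
    (ν : Measure Y) (S : Y ≃ᵐ Y) (lam : Measure (X × Y)) : Prop :=
  lam.map Prod.fst = μ ∧ lam.map Prod.snd = ν ∧ Ergodic (T.prodCongr S) lam

end Dynamics

/-- The joining primeness property of order `n`: for all `k ≥ n + 1`, all weakly mixing automorphisms
`S₁, …, S_k` of standard Borel probability spaces `(Yᵢ, νᵢ)` and every ergodic joining `lam` of `T`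
with `S₁ × ⋯ × S_k` there is a set `I` of `n` indices such that `lam` is the product of its projection
on `X × ∏_{i ∈ I} Yᵢ` and of `⨂_{j ∉ I} νⱼ`. Here `X × ∏ᵢ Yᵢ` is identified with
`(X × ∏_{i ∈ I} Yᵢ) × ∏_{j ∉ I} Yⱼ` by rearranging the coordinates. -/
def HasJP {X : Type u} [MeasurableSpace X] (n : ℕ) (μ : Measure X) (T : X ≃ᵐ X) : Prop :=
  ∀ (k : ℕ), n + 1 ≤ k → ∀ (Y : Fin k → Type v) [∀ i, MeasurableSpace (Y i)]
    [∀ i, StandardBorelSpace (Y i)] (ν : ∀ i, Measure (Y i)) [∀ i, IsProbabilityMeasure (ν i)]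
    (S : ∀ i, Y i ≃ᵐ Y i), (∀ i, IsWeaklyMixing (ν i) (S i)) →
    ∀ lam : Measure (X × (∀ i, Y i)),
      IsErgodicJoining μ T (Measure.pi ν) (MeasurableEquiv.piCongrRight S) lam →
      ∃ I : Finset (Fin k), I.card = n ∧
        lam.map (fun p => ((p.1, fun i : {i // i ∈ I} => p.2 i), fun j : {j // j ∉ I} => p.2 j)) =
          (lam.map fun p => (p.1, fun i : {i // i ∈ I} => p.2 i)).prod
            (Measure.pi fun j : {j // j ∉ I} => ν j)

end

/-!
Centred indicator functions on weakly mixing factors have atomless spectral measures, so a product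
of such functions over at least `n` of the coordinates has as spectral measure a convolution with at
least `n` atomless factors. This is singular to the maximal spectral type of `T`; hence in a joining
the product is orthogonal to every function of the first coordinate.

Write `lam_J` for `decouple lam ν J`, in which the coordinates outside `J` are made independent of
everything else. Expanding the centred indicators, the orthogonality says that the alternating sum
of the `lam_J` over `J ⊆ I` vanishes as soon as `I` has at least `n` elements. All `lam_J` are
ergodic, hence pairwise equal or mutually singular. If `I` is minimal with `lam_I = lam` and had `n`
elements or more, `lam` would be absolutely continuous with respect to the sum of the `lam_J`,
`J ⊂ I`, all of which are singular to `lam`. So `lam_I = lam` for some `I` with fewer than `n`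
elements, and then the coordinates outside any larger index set split off as well.
-/

/-! ### Cesàro means -/

section CesaroMean

variable {E : Type*} [NormedAddCommGroup E] [NormedSpace ℝ E]

/-- The Cesàro mean of the first `N` terms of a sequence; it is `0` at `N = 0`. Over `ℝ` it unfolds
to the expression in the definition of weak mixing. -/
noncomputable def cesaroMean (a : ℕ → E) (N : ℕ) : E :=
  (N : ℝ)⁻¹ • ∑ i ∈ Finset.range N, a i

theorem norm_cesaroMean_le (a : ℕ → E) (N : ℕ) : ‖cesaroMean a N‖ ≤ cesaroMean (‖a ·‖) N := by
  rw [cesaroMean, norm_smul, norm_inv, Real.norm_natCast]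
  exact mul_le_mul_of_nonneg_left (norm_sum_le _ _) (by positivity)

theorem cesaroMean_mono {a b : ℕ → ℝ} (h : ∀ i, a i ≤ b i) (N : ℕ) :
    cesaroMean a N ≤ cesaroMean b N :=
  mul_le_mul_of_nonneg_left (Finset.sum_le_sum fun i _ => h i) (by positivity)

theorem tendsto_cesaroMean_const (x : E) : Tendsto (cesaroMean fun _ => x) atTop (𝓝 x) :=
  tendsto_const_nhds.cesaro_smul

theorem tendsto_cesaroMean_zero_of_norm {a : ℕ → E}
    (h : Tendsto (cesaroMean (‖a ·‖)) atTop (𝓝 0)) : Tendsto (cesaroMean a) atTop (𝓝 0) :=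
  squeeze_zero_norm (norm_cesaroMean_le a) h

theorem integral_cesaroMean {α : Type*} [MeasurableSpace α] {m : Measure α} {f : ℕ → α → E}
    (hf : ∀ i, Integrable (f i) m) (N : ℕ) :
    ∫ x, cesaroMean (fun i => f i x) N ∂m = cesaroMean (fun i => ∫ x, f i x ∂m) N := by
  simp only [cesaroMean, integral_smul, integral_finsetSum _ fun i _ => hf i]

end CesaroMean

/-! ### Integration of continuous functions on a compact space -/

section ContinuousMapIntegral

variable {X : Type*} [TopologicalSpace X]

/-- A real continuous function, seen as a complex one. -/
noncomputable def continuousMapOfReal : C(X, ℝ) →L[ℝ] C(X, ℂ) :=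
  Complex.ofRealCLM.compLeftContinuous ℝ X

theorem continuousMapOfReal_apply (f : C(X, ℝ)) (z : X) : continuousMapOfReal f z = f z := rfl

theorem exists_continuousMapOfReal_add_I_smul (φ : C(X, ℂ)) :
    ∃ f g : C(X, ℝ), continuousMapOfReal f + Complex.I • continuousMapOfReal g = φ := by
  refine ⟨⟨fun z => (φ z).re, by fun_prop⟩, ⟨fun z => (φ z).im, by fun_prop⟩, ?_⟩
  ext z
  exact (congrArg _ (mul_comm _ _)).trans (Complex.re_add_im (φ z))

theorem eq_of_eqOn_continuousMapOfReal {L M : C(X, ℂ) →L[ℂ] ℂ}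
    (h : ∀ f : C(X, ℝ), L (continuousMapOfReal f) = M (continuousMapOfReal f)) : L = M := by
  ext φ
  obtain ⟨f, g, rfl⟩ := exists_continuousMapOfReal_add_I_smul φ
  simp only [map_add, map_smul, h]

variable [CompactSpace X] [MeasurableSpace X]

theorem integrable_continuousMap [OpensMeasurableSpace X] (σ : Measure X) [IsFiniteMeasure σ]
    (φ : C(X, ℂ)) : Integrable φ σ :=
  φ.continuous.integrable_of_hasCompactSupport (HasCompactSupport.of_compactSpace _)

/-- Integration against a finite measure on a compact space, as a continuous linear functional on
the continuous functions. -/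
noncomputable def continuousMapIntegral [OpensMeasurableSpace X] (σ : Measure X)
    [IsFiniteMeasure σ] : C(X, ℂ) →L[ℂ] ℂ :=
  LinearMap.mkContinuous
    { toFun := fun φ => ∫ z, φ z ∂σ
      map_add' := fun φ ψ =>
        integral_add (integrable_continuousMap σ φ) (integrable_continuousMap σ ψ)
      map_smul' := fun c φ => integral_smul c φ }
    (σ.real Set.univ) fun φ => by
      rw [mul_comm]
      exact norm_integral_le_of_norm_le_const (ae_of_all _ φ.norm_coe_le_norm)

variable [BorelSpace X]

/-- The complex form of the Riesz–Markov–Kakutani theorem. -/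
theorem exists_continuousMapIntegral_eq [T2Space X] (L : C(X, ℂ) →L[ℂ] ℂ)
    (hre : ∀ f : C(X, ℝ), 0 ≤ f → 0 ≤ (L (continuousMapOfReal f)).re)
    (him : ∀ f : C(X, ℝ), (L (continuousMapOfReal f)).im = 0) :
    ∃ (σ : Measure X) (_ : IsFiniteMeasure σ), continuousMapIntegral σ = L := by
  let Λ : CompactlySupportedContinuousMap X ℝ →ₚ[ℝ] ℝ := PositiveLinearMap.mk₀
    { toFun := fun f => (L (continuousMapOfReal f.toContinuousMap)).re
      map_add' := fun f g => by
        change (L (continuousMapOfReal (f.toContinuousMap + g.toContinuousMap))).re = _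
        rw [map_add, map_add, Complex.add_re]
      map_smul' := fun c f => by
        change (L (continuousMapOfReal (c • f.toContinuousMap))).re = _
        rw [map_smul, ← Complex.coe_smul, map_smul, smul_eq_mul, Complex.re_ofReal_mul]
        rfl }
    fun f hf => hre f.toContinuousMap hf
  let σ : Measure X := RealRMK.rieszMeasure Λ
  refine ⟨σ, inferInstance, eq_of_eqOn_continuousMapOfReal fun f => ?_⟩
  have hΛ : ∫ z, f z ∂σ = (L (continuousMapOfReal f)).re :=
    RealRMK.integral_rieszMeasure Λ ⟨f, HasCompactSupport.of_compactSpace _⟩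
  calc ∫ z, (f z : ℂ) ∂σ = ((L (continuousMapOfReal f)).re : ℂ) := by
        rw [integral_complex_ofReal, hΛ]
    _ = L (continuousMapOfReal f) := Complex.ext rfl (him f).symm

theorem ext_of_continuousMapIntegral_eq [HasOuterApproxClosed X] {σ τ : Measure X}
    [IsFiniteMeasure σ] [IsFiniteMeasure τ]
    (h : continuousMapIntegral σ = continuousMapIntegral τ) : σ = τ := by
  refine ext_of_forall_integral_eq_of_IsFiniteMeasure fun f => Complex.ofReal_injective ?_
  have hf : ∫ z, (f z : ℂ) ∂σ = ∫ z, (f z : ℂ) ∂τ :=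
    DFunLike.congr_fun h (continuousMapOfReal f.toContinuousMap)
  exact integral_ofReal.symm.trans (hf.trans integral_ofReal)

end ContinuousMapIntegral

/-! ### Fourier coefficients of measures on the circle -/

section CircleFourier

/-- The Laurent monomial `z ↦ zⁿ` on the circle. -/
noncomputable def circleMonomial (n : ℤ) : C(Circle, ℂ) where
  toFun z := ((z ^ n : Circle) : ℂ)
  continuous_toFun := continuous_subtype_val.comp (continuous_zpow n)

theorem circleMonomial_apply (n : ℤ) (z : Circle) :
    circleMonomial n z = ((z ^ n : Circle) : ℂ) := rfl

theorem circleMonomial_zero : circleMonomial 0 = 1 := by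
  ext z
  simp only [circleMonomial_apply, zpow_zero, Circle.coe_one, ContinuousMap.one_apply]

theorem circleMonomial_add (m n : ℤ) :
    circleMonomial (m + n) = circleMonomial m * circleMonomial n := by
  ext z
  simp only [circleMonomial_apply, zpow_add, ContinuousMap.mul_apply, Circle.coe_mul]

theorem dense_span_circleMonomial :
    Dense (Submodule.span ℂ (Set.range circleMonomial) : Set C(Circle, ℂ)) := by
  let e : UnitAddCircle ≃ₜ Circle := AddCircle.homeomorphCircle one_ne_zero
  let L : C(UnitAddCircle, ℂ) →ₐ[ℂ] C(Circle, ℂ) := ContinuousMap.compRightAlgHom ℂ ℂ e.symm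
  have hL : Function.Surjective L := fun φ =>
    ⟨φ.comp e, ContinuousMap.ext fun z => congrArg φ (e.apply_symm_apply z)⟩
  have hmonomial : ∀ n, L (fourier n) = circleMonomial n := by
    refine fun n => ContinuousMap.ext fun z => ?_
    obtain ⟨x, rfl⟩ := e.surjective z
    change fourier n (e.symm (e x)) = ((e x ^ n : Circle) : ℂ)
    rw [e.symm_apply_apply, fourier_apply, AddCircle.homeomorphCircle_apply,
      AddCircle.toCircle_zsmul]
  have hspan : (Submodule.span ℂ (Set.range circleMonomial) : Set C(Circle, ℂ)) =
      L '' Submodule.span ℂ (Set.range (fourier (T := 1))) := by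
    rw [← funext hmonomial, Set.range_comp' L, ← AlgHom.coe_toLinearMap, ← Submodule.map_span,
      Submodule.map_coe]
  rw [hspan]
  exact hL.denseRange.dense_image (ContinuousMap.compRightAlgHom_continuous ℂ ℂ _)
    (Submodule.dense_iff_topologicalClosure_eq_top.2 span_fourier_closure_eq_top)

theorem eq_of_eqOn_circleMonomial {F : Type*} [AddCommGroup F] [Module ℂ F] [TopologicalSpace F]
    [T2Space F] {f g : C(Circle, ℂ) →L[ℂ] F}
    (h : ∀ n, f (circleMonomial n) = g (circleMonomial n)) : f = g :=
  ContinuousLinearMap.ext_on dense_span_circleMonomial (by rintro - ⟨n, rfl⟩; exact h n)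

/-- The Fourier coefficient `∫ zᵐ dσ(z)`. -/
noncomputable def circleFourier (σ : Measure Circle) (m : ℤ) : ℂ := ∫ z, circleMonomial m z ∂σ

theorem circleFourier_neg (σ : Measure Circle) (m : ℤ) :
    circleFourier σ (-m) = (starRingEnd ℂ) (circleFourier σ m) := by
  simp_rw [circleFourier, ← integral_conj, circleMonomial_apply, zpow_neg, Circle.coe_inv_eq_conj]

theorem ext_of_circleFourier_eq {σ τ : Measure Circle} [IsFiniteMeasure σ] [IsFiniteMeasure τ]
    (h : ∀ m, circleFourier σ m = circleFourier τ m) : σ = τ :=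
  ext_of_continuousMapIntegral_eq (eq_of_eqOn_circleMonomial h)

theorem tendsto_cesaroMean_pow (z : Circle) :
    Tendsto (cesaroMean fun m => (z : ℂ) ^ m) atTop
      (𝓝 (({1} : Set Circle).indicator (fun _ => 1) z)) := by
  by_cases hz : z = 1
  · simpa [hz] using tendsto_cesaroMean_const (1 : ℂ)
  rw [Set.indicator_of_notMem (by simpa using hz)]
  have hz' : (z : ℂ) ≠ 1 := fun h => hz (Circle.ext (by simpa using h))
  have hbound : Tendsto (fun N : ℕ => (N : ℝ)⁻¹ * (2 / ‖(z : ℂ) - 1‖)) atTop (𝓝 0) := by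
    simpa using tendsto_inv_atTop_nhds_zero_nat.mul_const (2 / ‖(z : ℂ) - 1‖)
  refine squeeze_zero_norm (fun N => ?_) hbound
  rw [cesaroMean, norm_smul, norm_inv, Real.norm_natCast, geom_sum_eq hz', norm_div]
  gcongr
  calc ‖(z : ℂ) ^ N - 1‖ ≤ ‖(z : ℂ) ^ N‖ + ‖(1 : ℂ)‖ := norm_sub_le _ _
    _ = 2 := by rw [norm_pow, Circle.norm_coe, one_pow, norm_one, one_add_one_eq_two]

/-- **Wiener's lemma**, for a single atom. -/
theorem tendsto_cesaroMean_circleFourier_mul_pow (σ : Measure Circle) [IsFiniteMeasure σ]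
    (w : Circle) :
    Tendsto (cesaroMean fun m => circleFourier σ m * ((w⁻¹ : Circle) : ℂ) ^ m) atTop
      (𝓝 (σ.real {w})) := by
  classical
  have hpow : ∀ (m : ℕ) (z : Circle),
      circleMonomial m z * ((w⁻¹ : Circle) : ℂ) ^ m = ((z * w⁻¹ : Circle) : ℂ) ^ m := fun m z => by
    rw [circleMonomial_apply, zpow_natCast, Circle.coe_pow, Circle.coe_mul, mul_pow]
  have hintegrable : ∀ m : ℕ,
      Integrable (fun z => circleMonomial m z * ((w⁻¹ : Circle) : ℂ) ^ m) σ :=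
    fun m => (integrable_continuousMap σ _).mul_const _
  simp_rw [circleFourier, ← integral_mul_const]
  have hlimit :
      ∫ z, ({1} : Set Circle).indicator (fun _ => (1 : ℂ)) (z * w⁻¹) ∂σ = (σ.real {w} : ℂ) := by
    have : ∀ z : Circle, ({1} : Set Circle).indicator (fun _ => (1 : ℂ)) (z * w⁻¹) =
        ({w} : Set Circle).indicator (fun _ => 1) z := fun z => by
      simp only [Set.indicator_apply, Set.mem_singleton_iff, mul_inv_eq_one]
    simp_rw [this]
    rw [integral_indicator_const _ (measurableSet_singleton w), Complex.real_smul, mul_one]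
  rw [← hlimit]
  refine Tendsto.congr (integral_cesaroMean hintegrable) ?_
  refine tendsto_integral_of_dominated_convergence (fun _ => 1) (fun N => ?_)
    (integrable_const _) (fun N => ae_of_all _ fun z => ?_) (ae_of_all _ fun z => ?_)
  · exact ((integrable_finsetSum _ fun m _ => hintegrable m).smul _).aestronglyMeasurable
  · refine (norm_cesaroMean_le _ N).trans ?_
    simp only [hpow, norm_pow, Circle.norm_coe, one_pow, cesaroMean, Finset.sum_const,
      Finset.card_range, nsmul_eq_mul, mul_one, smul_eq_mul]
    exact inv_mul_le_one
  · simpa only [hpow] using tendsto_cesaroMean_pow (z * w⁻¹)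

theorem nullSingletonClass_of_tendsto_cesaroMean_circleFourier {σ : Measure Circle}
    [IsFiniteMeasure σ]
    (h : Tendsto (cesaroMean fun m => ‖circleFourier σ m‖) atTop (𝓝 0)) :
    NullSingletonClass σ := by
  refine ⟨fun w => ?_⟩
  have hzero := tendsto_cesaroMean_zero_of_norm
    (a := fun m : ℕ => circleFourier σ m * ((w⁻¹ : Circle) : ℂ) ^ m) <| by
      simpa only [norm_mul, norm_pow, Circle.norm_coe, one_pow, mul_one] using h
  have := tendsto_nhds_unique (tendsto_cesaroMean_circleFourier_mul_pow σ w) hzero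
  exact (measureReal_eq_zero_iff).1 (Complex.ofReal_eq_zero.1 this)

end CircleFourier

/-! ### Convolutions of finite families -/

section FamilyConvolution

variable {ι M : Type*} [Fintype ι] [CommMonoid M] [MeasurableSpace M]

/-- The convolution of a finite family of measures on a commutative monoid; `circleConvolution` is
the case of the index type `Fin n` and of the circle. -/
noncomputable def familyConvolution (σ : ι → Measure M) : Measure M :=
  (Measure.pi σ).map fun z => ∏ i, z i

instance (σ : ι → Measure M) [∀ i, IsFiniteMeasure (σ i)] :
    IsFiniteMeasure (familyConvolution σ) :=
  inferInstanceAs (IsFiniteMeasure (Measure.map _ _))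

theorem circleFourier_familyConvolution (σ : ι → Measure Circle) [∀ i, IsFiniteMeasure (σ i)]
    (m : ℤ) : circleFourier (familyConvolution σ) m = ∏ i, circleFourier (σ i) m := by
  have hprod : ∀ z : ι → Circle, circleMonomial m (∏ i, z i) = ∏ i, circleMonomial m (z i) := by
    intro z
    simp only [circleMonomial_apply, ← Finset.prod_zpow]
    exact map_prod Circle.coeHom _ _
  calc circleFourier (familyConvolution σ) m
      = ∫ z, circleMonomial m (∏ i, z i) ∂Measure.pi σ :=
        integral_map (by fun_prop) (circleMonomial m).continuous.aestronglyMeasurable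
    _ = ∏ i, circleFourier (σ i) m := by
        simp_rw [hprod]
        exact integral_fintype_prod_eq_prod fun _ z => circleMonomial m z

theorem nullSingletonClass_familyConvolution {G : Type*} [CommGroup G] [MeasurableSpace G]
    [MeasurableMul₂ G] [MeasurableSingletonClass G] (σ : ι → Measure G)
    [∀ i, IsFiniteMeasure (σ i)] (i : ι) [NullSingletonClass (σ i)] :
    NullSingletonClass (familyConvolution σ) := by
  classical
  refine ⟨fun w => ?_⟩
  have hprod : Measurable fun z : ι → G => ∏ i, z i := by fun_prop
  have hfiber : ∀ z : ι → G,
      ∫⁻ y, ({w} : Set G).indicator 1 (∏ j, Function.update z i y j) ∂σ i = 0 := by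
    intro z
    have : (fun y => ({w} : Set G).indicator (1 : G → ENNReal) (∏ j, Function.update z i y j)) =
        ({w * (∏ j ∈ Finset.univ \ {i}, z j)⁻¹} : Set G).indicator 1 := by
      ext y
      simp only [Finset.prod_update_of_mem (Finset.mem_univ i), Set.indicator_apply,
        Set.mem_singleton_iff, eq_mul_inv_iff_mul_eq]
      rfl
    rw [this, lintegral_indicator_one (measurableSet_singleton _), measure_singleton]
  rw [← lintegral_indicator_one (measurableSet_singleton w), familyConvolution,
    lintegral_map (measurable_one.indicator (measurableSet_singleton w)) hprod,
    lintegral_eq_lmarginal_univ 1, lmarginal_erase' _ _ (Finset.mem_univ i)]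
  · simp only [hfiber, lmarginal, lintegral_const, zero_mul]
  · exact (measurable_one.indicator (measurableSet_singleton w)).comp hprod

/-- Convolving a larger family only helps: the surplus factors are absorbed into the atomless ones,
which stay atomless. -/
theorem MeasureHasCS.mutuallySingular_familyConvolution {n : ℕ} (hn : 0 < n) {σ : Measure Circle}
    (h : MeasureHasCS n σ) (τ : ι → Measure Circle) [∀ i, IsFiniteMeasure (τ i)] (e : Fin n ↪ ι)
    [∀ j, NullSingletonClass (τ (e j))] : σ.MutuallySingular (familyConvolution τ) := by
  classical
  have : Nonempty (Fin n) := ⟨⟨0, hn⟩⟩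
  let c : ι → Fin n := Function.invFun e
  have hc : ∀ j, c (e j) = j := Function.leftInverse_invFun e.injective
  let ν : Fin n → Measure Circle := fun j => familyConvolution fun i : {i // c i = j} => τ i
  have hν : ∀ j, NullSingletonClass (ν j) := fun j =>
    nullSingletonClass_familyConvolution (fun i : {i // c i = j} => τ i) ⟨e j, hc j⟩
  have hconv : circleConvolution ν = familyConvolution τ :=
    ext_of_circleFourier_eq (σ := familyConvolution ν) fun m => by
      simp only [ν, circleFourier_familyConvolution]
      exact Fintype.prod_fiberwise c fun i => circleFourier (τ i) m
  exact hconv ▸ h ν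

end FamilyConvolution

/-! ### Spectral measures of unitary operators -/

section CircleCalculus

variable {H : Type*} [NormedAddCommGroup H] [InnerProductSpace ℂ H] [CompleteSpace H]

theorem coe_linearIsometryEquiv_mem_unitary (U : H ≃ₗᵢ[ℂ] H) :
    (U : H →L[ℂ] H) ∈ unitary (H →L[ℂ] H) :=
  (Unitary.linearIsometryEquiv.symm U).2

theorem isStarNormal_coe_linearIsometryEquiv (U : H ≃ₗᵢ[ℂ] H) :
    IsStarNormal (U : H →L[ℂ] H) :=
  isStarNormal_of_mem_unitary (coe_linearIsometryEquiv_mem_unitary U)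

/-- The inclusion into the circle of the spectrum of a unitary operator. -/
noncomputable def spectrumToCircle (U : H ≃ₗᵢ[ℂ] H) :
    C(spectrum ℂ (U : H →L[ℂ] H), Circle) where
  toFun z := ⟨z, spectrum.subset_circle_of_unitary (coe_linearIsometryEquiv_mem_unitary U) z.2⟩
  continuous_toFun := continuous_subtype_val.subtype_mk _

/-- The continuous functional calculus `φ ↦ φ(U)` of a unitary operator `U`, defined for functions
on the whole circle. -/
noncomputable def circleCalculus (U : H ≃ₗᵢ[ℂ] H) : C(Circle, ℂ) →⋆ₐ[ℂ] (H →L[ℂ] H) :=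
  (cfcHom (isStarNormal_coe_linearIsometryEquiv U)).comp
    (ContinuousMap.compStarAlgHom' ℂ ℂ (spectrumToCircle U))

theorem continuous_circleCalculus (U : H ≃ₗᵢ[ℂ] H) : Continuous (circleCalculus U) :=
  (cfcHom_continuous _).comp (ContinuousMap.continuous_precomp _)

theorem circleCalculus_circleMonomial_one (U : H ≃ₗᵢ[ℂ] H) :
    circleCalculus U (circleMonomial 1) = (U : H →L[ℂ] H) := by
  have hid : (circleMonomial 1).comp (spectrumToCircle U) =
      (ContinuousMap.id ℂ).restrict (spectrum ℂ (U : H →L[ℂ] H)) :=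
    ContinuousMap.ext fun z => congrArg Circle.coeHom (zpow_one (spectrumToCircle U z))
  exact (congrArg _ hid).trans (cfcHom_id (isStarNormal_coe_linearIsometryEquiv U))

theorem circleCalculus_circleMonomial (U : H ≃ₗᵢ[ℂ] H) (n : ℤ) :
    circleCalculus U (circleMonomial n) = ((U ^ n : H ≃ₗᵢ[ℂ] H) : H →L[ℂ] H) := by
  let monomialCalculus : Multiplicative ℤ →* (H →L[ℂ] H) :=
    { toFun := fun n => circleCalculus U (circleMonomial n.toAdd)
      map_one' := by rw [toAdd_one, circleMonomial_zero, map_one]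
      map_mul' := fun m n => by rw [toAdd_mul, circleMonomial_add, map_mul] }
  let powers : Multiplicative ℤ →* (H →L[ℂ] H) :=
    { toFun := fun n => ((U ^ n.toAdd : H ≃ₗᵢ[ℂ] H) : H →L[ℂ] H)
      map_one' := rfl
      map_mul' := fun m n => by rw [toAdd_mul, zpow_add]; rfl }
  have : monomialCalculus = powers := MonoidHom.ext_mint <|
    (circleCalculus_circleMonomial_one U).trans <|
      congrArg (fun V : H ≃ₗᵢ[ℂ] H => (V : H →L[ℂ] H)) (zpow_one U).symm
  exact DFunLike.congr_fun this (Multiplicative.ofAdd n)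

theorem inner_circleCalculus_star_left (U : H ≃ₗᵢ[ℂ] H) (φ : C(Circle, ℂ)) (x y : H) :
    inner ℂ (circleCalculus U (star φ) x) y = inner ℂ x (circleCalculus U φ y) := by
  rw [map_star, ContinuousLinearMap.star_eq_adjoint, ContinuousLinearMap.adjoint_inner_left]

/-- The functional `φ ↦ ⟨x, φ(U) x⟩`, which the spectral measure of `x` represents. -/
noncomputable def spectralFunctional (U : H ≃ₗᵢ[ℂ] H) (x : H) : C(Circle, ℂ) →L[ℂ] ℂ :=
  ((innerSL ℂ x).comp (ContinuousLinearMap.apply ℂ H x)).comp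
    ⟨(circleCalculus U).toAlgHom.toLinearMap, continuous_circleCalculus U⟩

theorem spectralFunctional_apply (U : H ≃ₗᵢ[ℂ] H) (x : H) (φ : C(Circle, ℂ)) :
    spectralFunctional U x φ = inner ℂ x (circleCalculus U φ x) := rfl

theorem isSpectralMeasure_iff_continuousMapIntegral_eq (U : H ≃ₗᵢ[ℂ] H) (x : H)
    (σ : Measure Circle) [IsFiniteMeasure σ] :
    IsSpectralMeasure U x σ ↔ continuousMapIntegral σ = spectralFunctional U x := by
  have hmonomial : ∀ n : ℤ,
      spectralFunctional U x (circleMonomial n) = inner ℂ x ((U ^ n) x) := fun n => by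
    rw [spectralFunctional_apply, circleCalculus_circleMonomial]
    rfl
  refine ⟨fun h => eq_of_eqOn_circleMonomial fun n => ?_, fun h => ⟨inferInstance, fun n => ?_⟩⟩
  · exact ((hmonomial n).trans (h.2 n)).symm
  · exact (hmonomial n).symm.trans (DFunLike.congr_fun h (circleMonomial n)).symm

theorem spectralFunctional_star_mul_self (U : H ≃ₗᵢ[ℂ] H) (x : H) (φ : C(Circle, ℂ)) :
    spectralFunctional U x (star φ * φ) = (‖circleCalculus U φ x‖ ^ 2 : ℝ) := by
  rw [spectralFunctional_apply, map_mul, mul_apply_eq_comp, ← inner_circleCalculus_star_left,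
    star_star, inner_self_eq_norm_sq_to_K, Complex.ofReal_pow]
  rfl

theorem IsSpectralMeasure.norm_circleCalculus_sq {U : H ≃ₗᵢ[ℂ] H} {x : H} {σ : Measure Circle}
    (h : IsSpectralMeasure U x σ) (φ : C(Circle, ℂ)) :
    ‖circleCalculus U φ x‖ ^ 2 = ∫ z, ‖φ z‖ ^ 2 ∂σ := by
  have := h.1
  refine Complex.ofReal_injective ?_
  rw [← spectralFunctional_star_mul_self,
    ← (isSpectralMeasure_iff_continuousMapIntegral_eq U x σ).1 h, ← integral_complex_ofReal]
  refine integral_congr_ae (ae_of_all _ fun z => ?_)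
  simp [← Complex.conj_mul']

theorem exists_isSpectralMeasure (U : H ≃ₗᵢ[ℂ] H) (x : H) :
    ∃ σ : Measure Circle, IsSpectralMeasure U x σ := by
  have hre : ∀ f : C(Circle, ℝ), 0 ≤ f →
      0 ≤ (spectralFunctional U x (continuousMapOfReal f)).re := by
    intro f hf
    let g : C(Circle, ℝ) := ⟨fun z => √(f z), by fun_prop⟩
    have hfg : continuousMapOfReal f = star (continuousMapOfReal g) * continuousMapOfReal g := by
      ext z
      have : √(f z) * √(f z) = f z := Real.mul_self_sqrt (hf z)
      simp [continuousMapOfReal_apply, g, ← Complex.ofReal_mul, this]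
    rw [hfg, spectralFunctional_star_mul_self, Complex.ofReal_re]
    positivity
  have him : ∀ f : C(Circle, ℝ), (spectralFunctional U x (continuousMapOfReal f)).im = 0 := by
    intro f
    have hstar : star (continuousMapOfReal f) = continuousMapOfReal f := by
      ext z
      simp [continuousMapOfReal_apply]
    rw [spectralFunctional_apply, ← Complex.conj_eq_iff_im, inner_conj_symm,
      ← inner_circleCalculus_star_left, hstar]
  obtain ⟨σ, _, hσ⟩ := exists_continuousMapIntegral_eq _ hre him
  exact ⟨σ, (isSpectralMeasure_iff_continuousMapIntegral_eq U x σ).2 hσ⟩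

theorem exists_boundedContinuous_integral_norm_sq_le_of_mutuallySingular {X : Type*}
    [TopologicalSpace X] [TopologicalSpace.PseudoMetrizableSpace X] [MeasurableSpace X]
    [BorelSpace X] {α β : Measure X} [IsFiniteMeasure α] [IsFiniteMeasure β]
    (h : α.MutuallySingular β) {ε : ℝ} (hε : 0 < ε) :
    ∃ φ : BoundedContinuousFunction X ℂ, ∫ z, ‖φ z‖ ^ 2 ∂α ≤ ε ∧ ∫ z, ‖1 - φ z‖ ^ 2 ∂β ≤ ε := by
  obtain ⟨s, hs, hαs, hβs⟩ := h
  have hmem : MemLp (s.indicator fun _ => (1 : ℂ)) (ENNReal.ofReal 2) (α + β) :=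
    memLp_indicator_const _ hs _ (Or.inr (measure_ne_top _ _))
  obtain ⟨φ, hφ, hφmem⟩ := hmem.exists_boundedContinuous_integral_rpow_sub_le two_pos hε
  simp only [Real.rpow_ofNat] at hφ
  have hint : Integrable (fun z => ‖s.indicator (fun _ => (1 : ℂ)) z - φ z‖ ^ 2) (α + β) := by
    rw [ENNReal.ofReal_ofNat] at hmem hφmem
    exact (hmem.sub hφmem).integrable_norm_pow two_ne_zero
  have hnonneg : ∀ z, 0 ≤ ‖s.indicator (fun _ => (1 : ℂ)) z - φ z‖ ^ 2 := fun z => by positivity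
  refine ⟨φ, ?_, ?_⟩
  · calc ∫ z, ‖φ z‖ ^ 2 ∂α = ∫ z, ‖s.indicator (fun _ => (1 : ℂ)) z - φ z‖ ^ 2 ∂α := by
          refine integral_congr_ae ?_
          filter_upwards [measure_eq_zero_iff_ae_notMem.1 hαs] with z hz
          rw [Set.indicator_of_notMem hz, zero_sub, norm_neg]
      _ ≤ _ := integral_mono_measure (Measure.le_add_right le_rfl) (ae_of_all _ hnonneg) hint
      _ ≤ ε := hφ
  · calc ∫ z, ‖1 - φ z‖ ^ 2 ∂β = ∫ z, ‖s.indicator (fun _ => (1 : ℂ)) z - φ z‖ ^ 2 ∂β := by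
          refine integral_congr_ae ?_
          filter_upwards [measure_eq_zero_iff_ae_notMem.1 hβs] with z hz
          rw [Set.indicator_of_mem (not_not.1 hz)]
      _ ≤ _ := integral_mono_measure (Measure.le_add_left le_rfl) (ae_of_all _ hnonneg) hint
      _ ≤ ε := hφ

theorem IsSpectralMeasure.inner_eq_zero_of_mutuallySingular {U : H ≃ₗᵢ[ℂ] H} {a b : H}
    {α β : Measure Circle} (ha : IsSpectralMeasure U a α) (hb : IsSpectralMeasure U b β)
    (h : α.MutuallySingular β) : inner ℂ a b = 0 := by
  have := ha.1
  have := hb.1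
  have hbound : ∀ ε : ℝ, 0 < ε → ‖inner ℂ a b‖ ≤ ε * (‖a‖ + ‖b‖) := by
    intro ε hε
    obtain ⟨φ, hφα, hφβ⟩ :=
      exists_boundedContinuous_integral_norm_sq_le_of_mutuallySingular h (pow_pos hε 2)
    let ψ : C(Circle, ℂ) := φ.toContinuousMap
    have hψa : ‖circleCalculus U (star ψ) a‖ ≤ ε := by
      refine le_of_sq_le_sq ?_ hε.le
      rw [ha.norm_circleCalculus_sq]
      simpa [ψ] using hφα
    have hψb : ‖circleCalculus U (1 - ψ) b‖ ≤ ε := by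
      refine le_of_sq_le_sq ?_ hε.le
      rwa [hb.norm_circleCalculus_sq]
    calc ‖inner ℂ a b‖
        = ‖inner ℂ (circleCalculus U (star ψ) a) b +
            inner ℂ a (circleCalculus U (1 - ψ) b)‖ := by
          rw [inner_circleCalculus_star_left, ← inner_add_right, ← add_apply, ← map_add,
            add_sub_cancel, map_one, one_apply_eq_self]
      _ ≤ ‖circleCalculus U (star ψ) a‖ * ‖b‖ + ‖a‖ * ‖circleCalculus U (1 - ψ) b‖ :=
          (norm_add_le _ _).trans (add_le_add (norm_inner_le_norm _ _) (norm_inner_le_norm _ _))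
      _ ≤ ε * ‖b‖ + ‖a‖ * ε := by gcongr
      _ = ε * (‖a‖ + ‖b‖) := by ring
  refine norm_le_zero_iff.1 (ge_of_tendsto (f := fun ε : ℝ => ε * (‖a‖ + ‖b‖)) (x := 𝓝[>] 0)
    ?_ (eventually_nhdsWithin_of_forall hbound))
  exact ((continuous_mul_const _).tendsto' 0 0 (zero_mul _)).mono_left nhdsWithin_le_nhds

end CircleCalculus

section EquivariantIsometry

variable {H K : Type*} [NormedAddCommGroup H] [InnerProductSpace ℂ H]
  [NormedAddCommGroup K] [InnerProductSpace ℂ K] {U : H ≃ₗᵢ[ℂ] H} {V : K ≃ₗᵢ[ℂ] K}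

theorem isSpectralMeasure_of_inner_pow_eq {x : H} {σ : Measure Circle} [IsFiniteMeasure σ]
    (h : ∀ n : ℕ, inner ℂ x ((U ^ n) x) = circleFourier σ n) : IsSpectralMeasure U x σ := by
  refine ⟨inferInstance, fun n => ?_⟩
  change _ = circleFourier σ n
  obtain ⟨m, rfl | rfl⟩ := n.eq_nat_or_neg
  · rw [zpow_natCast, h m]
  · rw [circleFourier_neg, ← h m, inner_conj_symm, ← (U ^ m).inner_map_map x, zpow_neg,
      zpow_natCast]
    exact congrArg _ ((U ^ m).apply_symm_apply x)

theorem IsSpectralMeasure.inner_pow {x : H} {σ : Measure Circle} (h : IsSpectralMeasure U x σ)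
    (n : ℕ) : inner ℂ x ((U ^ n) x) = circleFourier σ n := by
  rw [← zpow_natCast]
  exact h.2 n

theorem map_pow_apply_of_equivariant {W : H →ₗᵢ[ℂ] K} (hW : ∀ y, W (U y) = V (W y)) (n : ℕ)
    (y : H) : W ((U ^ n) y) = (V ^ n) (W y) := by
  induction n generalizing y with
  | zero => rfl
  | succ n ih =>
    rw [pow_succ, pow_succ]
    exact (ih (U y)).trans (congrArg _ (hW y))

theorem IsSpectralMeasure.map {x : H} {σ : Measure Circle} (h : IsSpectralMeasure U x σ)
    {W : H →ₗᵢ[ℂ] K} (hW : ∀ y, W (U y) = V (W y)) : IsSpectralMeasure V (W x) σ := by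
  have := h.1
  refine isSpectralMeasure_of_inner_pow_eq fun n => ?_
  rw [← map_pow_apply_of_equivariant hW, W.inner_map_map, h.inner_pow]

theorem eq_zero_of_eqOn_isHilbertSum_cyclicSpace [CompleteSpace H] {F : Type*}
    [NormedAddCommGroup F] [NormedSpace ℂ F] {ι : Type*} {x : ι → H}
    (hx : IsHilbertSum ℂ (fun i => cyclicSpace U (x i)) (fun i => (cyclicSpace U (x i)).subtypeₗᵢ))
    {L : H →L[ℂ] F} (hL : ∀ i (n : ℤ), L ((U ^ n) (x i)) = 0) : L = 0 := by
  have hcyclic : ∀ i, cyclicSpace U (x i) ≤ LinearMap.ker (L : H →ₗ[ℂ] F) := fun i => by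
    refine Submodule.topologicalClosure_minimal _ (Submodule.span_le.2 ?_) L.isClosed_ker
    rintro - ⟨n, rfl⟩
    exact hL i n
  ext y
  obtain ⟨w, rfl⟩ : ∃ w, hx.linearIsometryEquiv.symm w = y :=
    hx.linearIsometryEquiv.symm.surjective y
  have hsum := (hx.hasSum_linearIsometryEquiv_symm w).mapL L
  have hterm : ∀ i, L ((cyclicSpace U (x i)).subtypeₗᵢ (w i)) = 0 := fun i => hcyclic i (w i).2
  simp only [hterm] at hsum
  exact hsum.unique hasSum_zero

theorem IsMaximalSpectralType.inner_map_eq_zero [CompleteSpace H] [CompleteSpace K]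
    {σ β : Measure Circle} (hσ : IsMaximalSpectralType U σ) {W : H →ₗᵢ[ℂ] K}
    (hW : ∀ y, W (U y) = V (W y)) {b : K} (hb : IsSpectralMeasure V b β)
    (h : σ.MutuallySingular β) (y : H) : inner ℂ b (W y) = 0 := by
  obtain ⟨-, x, τ, hx, hτ, hτ_succ, -, hτ_zero⟩ := hσ
  have hτσ : ∀ i, τ i ≪ σ := fun i => by
    induction i with
    | zero => exact hτ_zero
    | succ i ih => exact (hτ_succ i).trans ih
  have hgenerator : ∀ i (n : ℤ), inner ℂ b (W ((U ^ n) (x i))) = 0 := fun i n => by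
    have hWn : ∀ y, (W.comp (U ^ n).toLinearIsometry) (U y) =
        V ((W.comp (U ^ n).toLinearIsometry) y) := fun y => by
      have hcomm : (U ^ n) (U y) = U ((U ^ n) y) :=
        DFunLike.congr_fun (Commute.self_zpow U n).symm.eq y
      exact (congrArg W hcomm).trans (hW _)
    exact hb.inner_eq_zero_of_mutuallySingular ((hτ i).map hWn)
      (h.symm.mono_ac Measure.AbsolutelyContinuous.rfl (hτσ i))
  exact DFunLike.congr_fun
    (eq_zero_of_eqOn_isHilbertSum_cyclicSpace hx (L := (innerSL ℂ b).comp W.toContinuousLinearMap)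
      hgenerator) y

end EquivariantIsometry

/-! ### Ergodicity and mixing in the mean -/

section Ergodicity

variable {α : Type*} [MeasurableSpace α] {m : Measure α} {R : α → α}

theorem iterate_compMeasurePreserving_indicatorConstLp [IsFiniteMeasure m]
    (hR : MeasurePreserving R m m) {s : Set α} (hs : MeasurableSet s) (i : ℕ) :
    (Lp.compMeasurePreservingₗᵢ ℝ R hR)^[i] (indicatorConstLp 2 hs (measure_ne_top m s) (1 : ℝ)) =
      indicatorConstLp 2 ((hR.iterate i).measurable hs) (measure_ne_top m _) 1 := by
  induction i with
  | zero => rfl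
  | succ i ih =>
    rw [Function.iterate_succ_apply', ih]
    rfl

theorem exists_tendsto_cesaroMean_measureReal [IsFiniteMeasure m] (hR : MeasurePreserving R m m)
    {s : Set α} (hs : MeasurableSet s) :
    ∃ f : α → ℝ, Integrable f m ∧ f ∘ R =ᵐ[m] f ∧ ∀ t, MeasurableSet t →
      Tendsto (cesaroMean fun i => m.real (R^[i] ⁻¹' s ∩ t)) atTop (𝓝 (∫ x in t, f x ∂m)) := by
  let W : Lp ℝ 2 m →L[ℝ] Lp ℝ 2 m :=
    (Lp.compMeasurePreservingₗᵢ ℝ R hR).toContinuousLinearMap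
  let oneOn (r : Set α) (hr : MeasurableSet r) : Lp ℝ 2 m :=
    indicatorConstLp 2 hr (measure_ne_top m r) 1
  let F := (W.eqLocus (1 : Lp ℝ 2 m →L[ℝ] Lp ℝ 2 m)).orthogonalProjectionOnto (oneOn s hs)
  refine ⟨F.1, (Lp.memLp F.1).integrable one_le_two, ?_, fun t ht => ?_⟩
  · have hF : Lp.compMeasurePreserving R hR F.1 = F.1 := F.2
    exact (Lp.coeFn_compMeasurePreserving F.1 hR).symm.trans (by rw [hF])
  have hmean : Tendsto (fun N => inner ℝ (oneOn t ht) (birkhoffAverage ℝ W id N (oneOn s hs)))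
      atTop (𝓝 (inner ℝ (oneOn t ht) F.1)) :=
    tendsto_const_nhds.inner (W.tendsto_birkhoffAverage_orthogonalProjection
      (LinearIsometry.norm_toContinuousLinearMap_le _) (oneOn s hs))
  rw [L2.inner_indicatorConstLp_one ht (measure_ne_top m t) F.1] at hmean
  refine hmean.congr fun N => ?_
  rw [birkhoffAverage, birkhoffSum, inner_smul_right, inner_sum, cesaroMean, smul_eq_mul]
  refine congrArg _ (Finset.sum_congr rfl fun i _ => ?_)
  rw [Set.inter_comm, ← L2.real_inner_indicatorConstLp_one_indicatorConstLp_one ht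
    ((hR.iterate i).measurable hs)]
  exact congrArg _ (iterate_compMeasurePreserving_indicatorConstLp hR hs i)

theorem tendsto_cesaroMean_measureReal_inter_univ [IsFiniteMeasure m]
    (hR : MeasurePreserving R m m) {s : Set α} (hs : MeasurableSet s) :
    Tendsto (cesaroMean fun i => m.real (R^[i] ⁻¹' s ∩ Set.univ)) atTop (𝓝 (m.real s)) := by
  simp only [Set.inter_univ, (hR.iterate _).measureReal_preimage hs.nullMeasurableSet]
  exact tendsto_cesaroMean_const _

theorem measureReal_inter_of_tendsto_cesaroMean (hR : MeasurePreserving R m m) {s t : Set α}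
    (hs : MeasurableSet s) (ht : MeasurableSet t) (hinv : R ⁻¹' t = t)
    (h : Tendsto (cesaroMean fun i => m.real (R^[i] ⁻¹' s ∩ t)) atTop
      (𝓝 (m.real s * m.real t))) :
    m.real (s ∩ t) = m.real s * m.real t := by
  have hconst (i : ℕ) : m.real (R^[i] ⁻¹' s ∩ t) = m.real (s ∩ t) := by
    rw [← (hR.iterate i).measureReal_preimage (hs.inter ht).nullMeasurableSet, Set.preimage_inter,
      Set.preimage_iterate_eq, Function.iterate_fixed hinv]
  simp only [hconst] at h
  exact tendsto_nhds_unique (tendsto_cesaroMean_const _) h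

variable [IsProbabilityMeasure m]

theorem tendsto_cesaroMean_measureReal_of_ergodic (hR : Ergodic R m) {s t : Set α}
    (hs : MeasurableSet s) (ht : MeasurableSet t) :
    Tendsto (cesaroMean fun i => m.real (R^[i] ⁻¹' s ∩ t)) atTop (𝓝 (m.real s * m.real t)) := by
  obtain ⟨f, hf, hinv, hlim⟩ := exists_tendsto_cesaroMean_measureReal hR.toMeasurePreserving hs
  obtain ⟨c, hc⟩ := hR.quasiErgodic.ae_eq_const_of_ae_eq_comp_ae hf.1 hinv
  have hint (r : Set α) : ∫ x in r, f x ∂m = c * m.real r := by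
    rw [integral_congr_ae (ae_restrict_of_ae hc)]
    simp [mul_comm]
  have hcs : c = m.real s := by
    refine tendsto_nhds_unique ?_
      (tendsto_cesaroMean_measureReal_inter_univ hR.toMeasurePreserving hs)
    simpa only [hint, probReal_univ, mul_one] using hlim Set.univ MeasurableSet.univ
  simpa only [hint, hcs] using hlim t ht

variable {C : Set (Set α)}

theorem tendsto_cesaroMean_measureReal_of_isPiSystem (hR : MeasurePreserving R m m)
    (hgen : ‹MeasurableSpace α› = MeasurableSpace.generateFrom C) (hC : IsPiSystem C)
    {s : Set α} (hs : MeasurableSet s)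
    (hmix : ∀ t ∈ C,
      Tendsto (cesaroMean fun i => m.real (R^[i] ⁻¹' s ∩ t)) atTop (𝓝 (m.real s * m.real t)))
    {t : Set α} (ht : MeasurableSet t) :
    Tendsto (cesaroMean fun i => m.real (R^[i] ⁻¹' s ∩ t)) atTop (𝓝 (m.real s * m.real t)) := by
  obtain ⟨f, hf, -, hlim⟩ := exists_tendsto_cesaroMean_measureReal hR hs
  have hconst {r : Set α} (hr : MeasurableSet r) :
      m.withDensityᵥ (fun _ => m.real s) r = m.real s * m.real r := by
    rw [withDensityᵥ_apply (integrable_const _) hr, setIntegral_const, smul_eq_mul, mul_comm]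
  have hdens : m.withDensityᵥ f = m.withDensityᵥ fun _ => m.real s := by
    refine VectorMeasure.ext_of_generateFrom C (fun r hr => ?_) hgen hC ?_
    · have hrm : MeasurableSet r := hgen ▸ MeasurableSpace.measurableSet_generateFrom hr
      rw [withDensityᵥ_apply hf hrm, hconst hrm]
      exact tendsto_nhds_unique (hlim r hrm) (hmix r hr)
    · rw [withDensityᵥ_apply hf MeasurableSet.univ, hconst MeasurableSet.univ, probReal_univ,
        mul_one]
      exact tendsto_nhds_unique (hlim _ MeasurableSet.univ)
        (tendsto_cesaroMean_measureReal_inter_univ hR hs)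
  rw [← hconst ht, ← hdens, withDensityᵥ_apply hf ht]
  exact hlim t ht

theorem ergodic_of_tendsto_cesaroMean_measureReal (hR : MeasurePreserving R m m)
    (hgen : ‹MeasurableSpace α› = MeasurableSpace.generateFrom C) (hC : IsPiSystem C)
    (hmix : ∀ s ∈ C, ∀ t ∈ C,
      Tendsto (cesaroMean fun i => m.real (R^[i] ⁻¹' s ∩ t)) atTop (𝓝 (m.real s * m.real t))) :
    Ergodic R m := by
  refine ⟨hR, ⟨fun t ht hinv => ?_⟩⟩
  have hindep_of_mem (s : Set α) (hs : s ∈ C) : m.real (s ∩ t) = m.real s * m.real t := by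
    have hsm : MeasurableSet s := hgen ▸ MeasurableSpace.measurableSet_generateFrom hs
    exact measureReal_inter_of_tendsto_cesaroMean hR hsm ht hinv
      (tendsto_cesaroMean_measureReal_of_isPiSystem hR hgen hC hsm (hmix s hs) ht)
  have hindep : m.restrict t = m t • m := by
    refine ext_of_generate_finite C hgen hC (fun s hs => ?_) (by simp)
    have hsm : MeasurableSet s := hgen ▸ MeasurableSpace.measurableSet_generateFrom hs
    rw [Measure.restrict_apply hsm, Measure.smul_apply, smul_eq_mul, mul_comm,
      ← ENNReal.toReal_eq_toReal_iff' (measure_ne_top _ _) (by finiteness), ENNReal.toReal_mul]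
    exact hindep_of_mem s hs
  have hcompl : m t * m tᶜ = 0 := by
    simpa [Measure.restrict_apply ht.compl] using (congrArg (fun ρ => ρ tᶜ) hindep).symm
  rw [eventuallyConst_set']
  exact (mul_eq_zero.1 hcompl).imp ae_eq_empty.2 ae_eq_univ.2

theorem abs_measureReal_le_one {β : Type*} [MeasurableSpace β] (τ : Measure β)
    [IsProbabilityMeasure τ] (s : Set β) : |τ.real s| ≤ 1 :=
  (abs_of_nonneg measureReal_nonneg).trans_le measureReal_le_one

theorem abs_prod_sub_prod_le_sum {ι : Type*} (s : Finset ι) {a b : ι → ℝ}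
    (ha : ∀ i, |a i| ≤ 1) (hb : ∀ i, |b i| ≤ 1) :
    |∏ i ∈ s, a i - ∏ i ∈ s, b i| ≤ ∑ i ∈ s, |a i - b i| := by
  classical
  induction s using Finset.induction_on with
  | empty => simp
  | insert i s hi ih =>
    rw [Finset.prod_insert hi, Finset.prod_insert hi, Finset.sum_insert hi]
    have hprod : |∏ j ∈ s, a j| ≤ 1 := by
      rw [Finset.abs_prod]
      exact Finset.prod_le_one (fun _ _ => abs_nonneg _) fun j _ => ha j
    calc |a i * ∏ j ∈ s, a j - b i * ∏ j ∈ s, b j|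
        = |(a i - b i) * ∏ j ∈ s, a j + b i * (∏ j ∈ s, a j - ∏ j ∈ s, b j)| := by ring_nf
      _ ≤ |a i - b i| * |∏ j ∈ s, a j| + |b i| * |∏ j ∈ s, a j - ∏ j ∈ s, b j| := by
        rw [← abs_mul, ← abs_mul]
        exact abs_add_le _ _
      _ ≤ |a i - b i| * 1 + 1 * ∑ j ∈ s, |a j - b j| := by gcongr; exact hb i
      _ = |a i - b i| + ∑ j ∈ s, |a j - b j| := by ring

theorem tendsto_cesaroMean_mul_prod {ι : Type*} [Fintype ι] {a : ℕ → ℝ} {a₀ : ℝ}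
    {b : ℕ → ι → ℝ} {b₀ : ι → ℝ} (ha : ∀ i, |a i| ≤ 1) (hb : ∀ i j, |b i j| ≤ 1)
    (hb₀ : ∀ j, |b₀ j| ≤ 1) (halim : Tendsto (cesaroMean a) atTop (𝓝 a₀))
    (hblim : ∀ j, Tendsto (cesaroMean fun i => |b i j - b₀ j|) atTop (𝓝 0)) :
    Tendsto (cesaroMean fun i => a i * ∏ j, b i j) atTop (𝓝 (a₀ * ∏ j, b₀ j)) := by
  have hle (i : ℕ) : ‖a i * (∏ j, b i j - ∏ j, b₀ j)‖ ≤ ∑ j, |b i j - b₀ j| := by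
    rw [norm_mul]
    exact (mul_le_of_le_one_left (norm_nonneg _) (ha i)).trans
      (abs_prod_sub_prod_le_sum _ (hb i) hb₀)
  have hsum : Tendsto (cesaroMean fun i => ∑ j, |b i j - b₀ j|) atTop (𝓝 0) := by
    have h := tendsto_finsetSum Finset.univ fun j _ => hblim j
    simp only [cesaroMean, ← Finset.smul_sum, Finset.sum_const_zero] at h
    exact h.congr fun N => congrArg ((N : ℝ)⁻¹ • ·) Finset.sum_comm
  have hdiff : Tendsto (cesaroMean fun i => a i * (∏ j, b i j - ∏ j, b₀ j)) atTop (𝓝 0) :=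
    squeeze_zero_norm
      (fun N => (norm_cesaroMean_le _ N).trans (cesaroMean_mono hle N)) hsum
  have h := hdiff.add (halim.mul_const (∏ j, b₀ j))
  rw [zero_add] at h
  refine h.congr fun N => ?_
  simp only [cesaroMean, smul_eq_mul, mul_assoc, Finset.sum_mul, ← mul_add,
    ← Finset.sum_add_distrib, sub_add_cancel]

end Ergodicity

/-- The boxes `B × ∏ᵢ Aᵢ` with measurable sides. -/
def measurableBoxes (α : Type*) [MeasurableSpace α] {ι : Type*} (Y : ι → Type*)
    [∀ i, MeasurableSpace (Y i)] : Set (Set (α × ∀ i, Y i)) :=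
  Set.image2 (· ×ˢ ·) {s | MeasurableSet s}
    (Set.pi Set.univ '' Set.pi Set.univ fun i => {s : Set (Y i) | MeasurableSet s})

theorem preimage_iterate_prodMap_box_inter {α ι : Type*} {Y : ι → Type*} (R : α → α)
    (S : ∀ i, Y i → Y i) (B B' : Set α) (A A' : ∀ i, Set (Y i)) (i : ℕ) :
    (Prod.map R (Pi.map S))^[i] ⁻¹' (B ×ˢ Set.univ.pi A) ∩ B' ×ˢ Set.univ.pi A' =
      (R^[i] ⁻¹' B ∩ B') ×ˢ Set.univ.pi fun j => (S j)^[i] ⁻¹' A j ∩ A' j := by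
  rw [Prod.map_iterate, Pi.map_iterate, Set.pi_inter_distrib, ← Set.prod_inter_prod]
  rfl

section Boxes

variable {α : Type*} [MeasurableSpace α] {ι : Type*} {Y : ι → Type*} [∀ i, MeasurableSpace (Y i)]

theorem exists_eq_of_mem_measurableBoxes {s : Set (α × ∀ i, Y i)} (hs : s ∈ measurableBoxes α Y) :
    ∃ (B : Set α) (A : ∀ i, Set (Y i)), MeasurableSet B ∧ (∀ i, MeasurableSet (A i)) ∧
      B ×ˢ Set.univ.pi A = s := by
  obtain ⟨B, hB, _, ⟨A, hA, rfl⟩, rfl⟩ := hs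
  exact ⟨B, A, hB, fun i => hA i trivial, rfl⟩

theorem generateFrom_measurableBoxes [Finite ι] :
    MeasurableSpace.generateFrom (measurableBoxes α Y) = Prod.instMeasurableSpace :=
  generateFrom_eq_prod MeasurableSpace.generateFrom_measurableSet generateFrom_pi
    isCountablySpanning_measurableSet
    ⟨fun _ => Set.univ, fun _ => ⟨fun _ => Set.univ, by simp, by simp⟩, Set.iUnion_const _⟩

theorem isPiSystem_measurableBoxes : IsPiSystem (measurableBoxes α Y) :=
  MeasurableSpace.isPiSystem_measurableSet.prod isPiSystem_pi

theorem univ_mem_measurableBoxes : Set.univ ∈ measurableBoxes α Y :=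
  ⟨Set.univ, MeasurableSet.univ, Set.univ, ⟨fun _ => Set.univ, by simp, by simp⟩, by simp⟩

variable [Fintype ι] {m : Measure α} {R : α → α} {ν : ∀ i, Measure (Y i)}

theorem measureReal_prod_pi_box [SFinite m] [∀ i, SigmaFinite (ν i)] (B : Set α)
    (A : ∀ i, Set (Y i)) :
    (m.prod (Measure.pi ν)).real (B ×ˢ Set.univ.pi A) = m.real B * ∏ i, (ν i).real (A i) := by
  simp only [Measure.real, Measure.prod_prod, Measure.pi_pi, ENNReal.toReal_mul,
    ENNReal.toReal_prod]

theorem ergodic_prodMap_piMap [IsProbabilityMeasure m] (hR : Ergodic R m)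
    [∀ i, IsProbabilityMeasure (ν i)] {S : ∀ i, Y i ≃ᵐ Y i}
    (hS : ∀ i, IsWeaklyMixing (ν i) (S i)) :
    Ergodic (Prod.map R (Pi.map fun i => S i)) (m.prod (Measure.pi ν)) := by
  refine ergodic_of_tendsto_cesaroMean_measureReal
    (hR.toMeasurePreserving.prod (measurePreserving_pi _ _ fun i => (hS i).1))
    generateFrom_measurableBoxes.symm isPiSystem_measurableBoxes fun s hs t ht => ?_
  obtain ⟨B, A, hB, hA, rfl⟩ := exists_eq_of_mem_measurableBoxes hs
  obtain ⟨B', A', hB', hA', rfl⟩ := exists_eq_of_mem_measurableBoxes ht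
  have hlim := tendsto_cesaroMean_mul_prod (a := fun i => m.real (R^[i] ⁻¹' B ∩ B'))
    (b := fun i j => (ν j).real ((S j)^[i] ⁻¹' A j ∩ A' j))
    (b₀ := fun j => (ν j).real (A j) * (ν j).real (A' j)) (fun _ => abs_measureReal_le_one _ _)
    (fun _ _ => abs_measureReal_le_one _ _)
    (fun j => by
      rw [abs_mul]
      exact mul_le_one₀ (abs_measureReal_le_one _ _) (abs_nonneg _) (abs_measureReal_le_one _ _))
    (tendsto_cesaroMean_measureReal_of_ergodic hR hB hB')
    (fun j => (hS j).2 _ _ (hA j) (hA' j))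
  rw [Finset.prod_mul_distrib, mul_mul_mul_comm] at hlim
  simpa only [preimage_iterate_prodMap_box_inter, measureReal_prod_pi_box] using hlim

end Boxes

theorem eq_or_mutuallySingular_of_ergodic {α : Type*} [MeasurableSpace α] {m₁ m₂ : Measure α}
    [IsProbabilityMeasure m₁] [IsProbabilityMeasure m₂] {R : α → α} (h₁ : Ergodic R m₁)
    (h₂ : Ergodic R m₂) : m₁ = m₂ ∨ m₁.MutuallySingular m₂ := by
  obtain ⟨c, hc⟩ := h₂.eq_smul_of_absolutelyContinuous
    (h₁.toMeasurePreserving.withDensity_rnDeriv h₂.toMeasurePreserving)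
    (withDensity_absolutelyContinuous _ _)
  rcases eq_or_ne c 0 with rfl | hc0
  · right
    rw [← Measure.rnDeriv_add_singularPart m₁ m₂, hc, zero_smul, zero_add]
    exact Measure.mutuallySingular_singularPart _ _
  · left
    have hac : m₂ ≪ m₁ :=
      (hc ▸ Measure.absolutelyContinuous_smul hc0).trans
        (Measure.absolutelyContinuous_of_le (Measure.withDensity_rnDeriv_le _ _))
    exact (h₁.eq_of_absolutelyContinuous h₂.toMeasurePreserving hac).symm

/-! ### Koopman operators -/

section Koopman

variable {α β : Type*} [MeasurableSpace α] [MeasurableSpace β] {m : Measure α} {R : α ≃ᵐ α}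

theorem koopman_pow_toLp (hR : MeasurePreserving R m m) {f : α → ℂ} (hf : MemLp f 2 m) (n : ℕ) :
    (koopman m R hR ^ n) (hf.toLp f) =
      (hf.comp_measurePreserving (hR.iterate n)).toLp (f ∘ R^[n]) := by
  induction n with
  | zero => rfl
  | succ n ih =>
    rw [pow_succ']
    exact congrArg (koopman m R hR) ih

theorem inner_toLp_toLp {f g : α → ℂ} (hf : MemLp f 2 m) (hg : MemLp g 2 m) :
    inner ℂ (hf.toLp f) (hg.toLp g) = ∫ x, (starRingEnd ℂ) (f x) * g x ∂m := by
  rw [L2.inner_def]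
  refine integral_congr_ae ?_
  filter_upwards [hf.coeFn_toLp, hg.coeFn_toLp] with x hfx hgx
  rw [hfx, hgx, RCLike.inner_apply, mul_comm]

theorem inner_koopman_pow_toLp (hR : MeasurePreserving R m m) {f : α → ℂ} (hf : MemLp f 2 m)
    (n : ℕ) :
    inner ℂ (hf.toLp f) ((koopman m R hR ^ n) (hf.toLp f)) =
      ∫ x, (starRingEnd ℂ) (f x) * f (R^[n] x) ∂m := by
  rw [koopman_pow_toLp, inner_toLp_toLp]
  rfl

theorem compMeasurePreserving_koopman {m' : Measure β} {Q : β ≃ᵐ β}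
    (hR : MeasurePreserving R m m) (hQ : MeasurePreserving Q m' m') {π : β → α}
    (hπ : MeasurePreserving π m' m) (h : Function.Semiconj π Q R) (f : Lp ℂ 2 m) :
    Lp.compMeasurePreservingₗᵢ ℂ π hπ (koopman m R hR f) =
      koopman m' Q hQ (Lp.compMeasurePreservingₗᵢ ℂ π hπ f) := by
  change Lp.compMeasurePreserving π hπ (Lp.compMeasurePreserving R hR f) =
    Lp.compMeasurePreserving Q hQ (Lp.compMeasurePreserving π hπ f)
  rw [← Lp.compMeasurePreserving_comp_apply, ← Lp.compMeasurePreserving_comp_apply]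
  simp only [h.comp_eq]

end Koopman

section TensorProduct

variable {ι : Type*} [Fintype ι] {Y : ι → Type*} [∀ i, MeasurableSpace (Y i)]
  {ν : ∀ i, Measure (Y i)} [∀ i, SigmaFinite (ν i)] {f : ∀ i, Y i → ℂ}

theorem memLp_two_pi_prod (hf : ∀ i, MemLp (f i) 2 (ν i)) :
    MemLp (fun y : ∀ i, Y i => ∏ i, f i (y i)) 2 (Measure.pi ν) := by
  have hmeas : AEStronglyMeasurable (fun y : ∀ i, Y i => ∏ i, f i (y i)) (Measure.pi ν) :=
    Finset.aestronglyMeasurable_fun_prod _ fun i _ =>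
      (hf i).1.comp_quasiMeasurePreserving (Measure.quasiMeasurePreserving_eval _ i)
  rw [memLp_two_iff_integrable_sq_norm hmeas]
  simp only [norm_prod, ← Finset.prod_pow]
  exact Integrable.fintype_prod_dep fun i => (memLp_two_iff_integrable_sq_norm (hf i).1).1 (hf i)

theorem isSpectralMeasure_toLp_pi_prod {S : ∀ i, Y i ≃ᵐ Y i}
    (hS : ∀ i, MeasurePreserving (S i) (ν i) (ν i))
    (hSpi : MeasurePreserving (MeasurableEquiv.piCongrRight S) (Measure.pi ν) (Measure.pi ν))
    (hf : ∀ i, MemLp (f i) 2 (ν i)) {σ : ι → Measure Circle} [∀ i, IsFiniteMeasure (σ i)]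
    (hσ : ∀ i, IsSpectralMeasure (koopman (ν i) (S i) (hS i)) ((hf i).toLp (f i)) (σ i)) :
    IsSpectralMeasure (koopman (Measure.pi ν) (MeasurableEquiv.piCongrRight S) hSpi)
      ((memLp_two_pi_prod hf).toLp _) (familyConvolution σ) := by
  refine isSpectralMeasure_of_inner_pow_eq fun n => ?_
  have hiterate : (MeasurableEquiv.piCongrRight S)^[n] = Pi.map fun i => (S i)^[n] :=
    Pi.map_iterate (fun i => S i) n
  simp only [inner_koopman_pow_toLp, hiterate, Pi.map_apply, map_prod, ← Finset.prod_mul_distrib,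
    circleFourier_familyConvolution, ← (hσ _).inner_pow]
  exact integral_fintype_prod_eq_prod fun i y => (starRingEnd ℂ) (f i y) * f i ((S i)^[n] y)

end TensorProduct

section CenteredIndicator

variable {α : Type*} [MeasurableSpace α] {m : Measure α} {A : Set α}

/-- The indicator function of a set minus its mean: the projection of the indicator to the
orthogonal complement of the constants. -/
noncomputable def centeredIndicator (m : Measure α) (A : Set α) (x : α) : ℂ :=
  A.indicator 1 x - m.real A

theorem conj_centeredIndicator (m : Measure α) (A : Set α) (x : α) :
    (starRingEnd ℂ) (centeredIndicator m A x) = centeredIndicator m A x := by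
  by_cases hx : x ∈ A <;> simp [centeredIndicator, hx]

theorem memLp_centeredIndicator [IsFiniteMeasure m] (hA : MeasurableSet A) (p : ENNReal) :
    MemLp (centeredIndicator m A) p m :=
  (memLp_indicator_const p hA 1 (Or.inr (measure_ne_top m A))).sub (memLp_const _)

theorem setIntegral_centeredIndicator [IsFiniteMeasure m] (hA : MeasurableSet A) (s : Set α) :
    ∫ x in s, centeredIndicator m A x ∂m = (m.real (A ∩ s) - m.real A * m.real s : ℝ) := by
  have hindicator : Integrable (A.indicator (1 : α → ℂ)) (m.restrict s) :=
    (integrable_const 1).indicator hA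
  simp only [centeredIndicator]
  rw [integral_sub hindicator (integrable_const _), setIntegral_const, integral_indicator hA]
  simp [Measure.restrict_restrict hA, mul_comm]

theorem integral_centeredIndicator_mul_comp [IsProbabilityMeasure m] (hA : MeasurableSet A)
    {R : α → α} (hR : MeasurePreserving R m m) :
    ∫ x, (starRingEnd ℂ) (centeredIndicator m A x) * centeredIndicator m A (R x) ∂m =
      (m.real (R ⁻¹' A ∩ A) - m.real A * m.real A : ℝ) := by
  have hint : Integrable (centeredIndicator m A) m :=
    memLp_one_iff_integrable.1 (memLp_centeredIndicator hA 1)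
  have hmean : ∫ x, centeredIndicator m A x ∂m = 0 := by
    rw [← setIntegral_univ, setIntegral_centeredIndicator hA]
    simp
  have hpoint (x : α) : (starRingEnd ℂ) (centeredIndicator m A x) * centeredIndicator m A (R x) =
      (R ⁻¹' A).indicator (centeredIndicator m A) x - m.real A * centeredIndicator m A x := by
    by_cases hx : x ∈ A <;> by_cases hRx : R x ∈ A <;> simp [centeredIndicator, hx, hRx] <;> ring
  simp only [hpoint]
  rw [integral_sub (hint.indicator (hR.measurable hA)) (hint.const_mul _), integral_const_mul,
    hmean, mul_zero, sub_zero, integral_indicator (hR.measurable hA),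
    setIntegral_centeredIndicator hA, hR.measureReal_preimage hA.nullMeasurableSet, Set.inter_comm]

theorem IsWeaklyMixing.nullSingletonClass [IsProbabilityMeasure m] {S : α ≃ᵐ α}
    (hS : IsWeaklyMixing m S) (hA : MeasurableSet A) {σ : Measure Circle}
    (hσ : IsSpectralMeasure (koopman m S hS.1) ((memLp_centeredIndicator hA 2).toLp _) σ) :
    NullSingletonClass σ := by
  have := hσ.1
  refine nullSingletonClass_of_tendsto_cesaroMean_circleFourier ?_
  simp only [← hσ.inner_pow, inner_koopman_pow_toLp,
    integral_centeredIndicator_mul_comp hA (hS.1.iterate _), Complex.norm_real, Real.norm_eq_abs]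
  exact hS.2 A A hA hA

end CenteredIndicator

section Joining

variable {X : Type*} [MeasurableSpace X] {μ : Measure X} {T : X ≃ᵐ X}
  {hT : MeasurePreserving T μ μ} {ι : Type*} [Fintype ι] {Y : ι → Type*}
  [∀ i, MeasurableSpace (Y i)] {ν : ∀ i, Measure (Y i)} [∀ i, IsProbabilityMeasure (ν i)]
  {S : ∀ i, Y i ≃ᵐ Y i} {lam : Measure (X × ∀ i, Y i)}

theorem IsErgodicJoining.isProbabilityMeasure {Z : Type*} [MeasurableSpace Z] {ρ : Measure Z}
    [hρ : IsProbabilityMeasure ρ] {Q : Z ≃ᵐ Z} {lam : Measure (X × Z)}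
    (hlam : IsErgodicJoining μ T ρ Q lam) : IsProbabilityMeasure lam := by
  rw [← hlam.2.1] at hρ
  exact Measure.isProbabilityMeasure_of_map Prod.snd

theorem IsErgodicJoining.integral_conj_mul_eq_zero {Z : Type*} [MeasurableSpace Z] {ρ : Measure Z}
    {Q : Z ≃ᵐ Z} (hQ : MeasurePreserving Q ρ ρ) {lam : Measure (X × Z)}
    (hlam : IsErgodicJoining μ T ρ Q lam) {σ β : Measure Circle}
    (hσ : IsMaximalSpectralType (koopman μ T hT) σ) {g : Z → ℂ} (hg : MemLp g 2 ρ)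
    (hβ : IsSpectralMeasure (koopman ρ Q hQ) (hg.toLp g) β) (h : σ.MutuallySingular β)
    {f : X → ℂ} (hf : MemLp f 2 μ) : ∫ p, (starRingEnd ℂ) (g p.2) * f p.1 ∂lam = 0 := by
  obtain ⟨hfst, hsnd, herg⟩ := hlam
  have hfst : MeasurePreserving Prod.fst lam μ := ⟨measurable_fst, hfst⟩
  have hsnd : MeasurePreserving Prod.snd lam ρ := ⟨measurable_snd, hsnd⟩
  have hzero := hσ.inner_map_eq_zero
    (compMeasurePreserving_koopman hT herg.toMeasurePreserving hfst fun _ => rfl)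
    (hβ.map (compMeasurePreserving_koopman hQ herg.toMeasurePreserving hsnd fun _ => rfl)) h
    (hf.toLp f)
  exact (inner_toLp_toLp (hg.comp_measurePreserving hsnd)
    (hf.comp_measurePreserving hfst)).symm.trans hzero

theorem HasCS.integral_prod_centeredIndicator_eq_zero {n : ℕ} (hn : 0 < n) (hCS : HasCS n μ T hT)
    (hS : ∀ i, IsWeaklyMixing (ν i) (S i))
    (hlam : IsErgodicJoining μ T (Measure.pi ν) (MeasurableEquiv.piCongrRight S) lam)
    {I : Finset ι} (hI : n ≤ I.card) {A : ∀ i, Set (Y i)} (hA : ∀ i, MeasurableSet (A i))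
    {f : X → ℂ} (hf : MemLp f 2 μ) :
    ∫ p, f p.1 * ∏ i ∈ I, centeredIndicator (ν i) (A i) (p.2 i) ∂lam = 0 := by
  classical
  let g (i : ι) (y : Y i) : ℂ := if i ∈ I then centeredIndicator (ν i) (A i) y else 1
  have hg (i : ι) : MemLp (g i) 2 (ν i) := by
    by_cases hi : i ∈ I
    · simpa only [g, hi, if_true] using memLp_centeredIndicator (hA i) 2
    · simpa only [g, hi, if_false] using memLp_const 1
  choose σ hσ using fun i => exists_isSpectralMeasure (koopman (ν i) (S i) (hS i).1) ((hg i).toLp _)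
  have (i : ι) : IsFiniteMeasure (σ i) := (hσ i).1
  have hcont (i : ι) (hi : i ∈ I) : NullSingletonClass (σ i) := by
    refine (hS i).nullSingletonClass (hA i) ?_
    simpa only [g, hi, if_true] using hσ i
  obtain ⟨J, hJI, hJ⟩ := Finset.exists_subset_card_eq hI
  let e : Fin n ↪ ι := (J.equivFinOfCardEq hJ).symm.toEmbedding.trans (Function.Embedding.subtype _)
  have (j : Fin n) : NullSingletonClass (σ (e j)) :=
    hcont _ (hJI ((J.equivFinOfCardEq hJ).symm j).2)
  have hSpi : MeasurePreserving (MeasurableEquiv.piCongrRight S) (Measure.pi ν) (Measure.pi ν) :=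
    measurePreserving_pi _ _ fun i => (hS i).1
  obtain ⟨ρ, hρ, hρCS⟩ := hCS
  have hzero := hlam.integral_conj_mul_eq_zero hSpi hρ (memLp_two_pi_prod hg)
    (isSpectralMeasure_toLp_pi_prod (fun i => (hS i).1) hSpi hg hσ)
    (hρCS.mutuallySingular_familyConvolution hn σ e) hf
  simpa only [g, Finset.prod_ite_mem, Finset.univ_inter, map_prod, conj_centeredIndicator,
    mul_comm (f _)] using hzero

end Joining

/-! ### Decoupling coordinates -/

section Correlations

variable {X ι : Type*} {Y : ι → Type*} {B : Set X} {A : ∀ i, Set (Y i)}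

theorem indicator_mul_prod_indicator (J : Finset ι) (p : X × ∀ i, Y i) :
    B.indicator (1 : X → ℂ) p.1 * ∏ i ∈ J, (A i).indicator (1 : Y i → ℂ) (p.2 i) =
      (B ×ˢ (J : Set ι).pi A).indicator 1 p := by
  rw [← Set.indicator_pi_one_apply, ← Set.indicator_prod_one]

theorem integral_indicator_mul_prod_centeredIndicator [DecidableEq ι] [MeasurableSpace X]
    [∀ i, MeasurableSpace (Y i)] {lam : Measure (X × ∀ i, Y i)} [IsFiniteMeasure lam]
    {ν : ∀ i, Measure (Y i)} (I : Finset ι) (hB : MeasurableSet B)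
    (hA : ∀ i, MeasurableSet (A i)) :
    ∫ p, B.indicator 1 p.1 * ∏ i ∈ I, centeredIndicator (ν i) (A i) (p.2 i) ∂lam =
      (∑ J ∈ I.powerset, (-1) ^ (I \ J).card *
        (lam.real (B ×ˢ (J : Set ι).pi A) * ∏ i ∈ I \ J, (ν i).real (A i)) : ℝ) := by
  have hbox (J : Finset ι) : MeasurableSet (B ×ˢ (J : Set ι).pi A) :=
    hB.prod (MeasurableSet.pi J.countable_toSet fun i _ => hA i)
  have hexpand (p : X × ∀ i, Y i) :
      B.indicator 1 p.1 * ∏ i ∈ I, centeredIndicator (ν i) (A i) (p.2 i) =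
        ∑ J ∈ I.powerset, (B ×ˢ (J : Set ι).pi A).indicator (1 : X × (∀ i, Y i) → ℂ) p *
          ∏ i ∈ I \ J, -((ν i).real (A i) : ℂ) := by
    simp only [centeredIndicator, sub_eq_add_neg, Finset.prod_add, Finset.mul_sum, ← mul_assoc,
      indicator_mul_prod_indicator]
  have hintegrable (J : Finset ι) :
      Integrable ((B ×ˢ (J : Set ι).pi A).indicator (1 : X × (∀ i, Y i) → ℂ)) lam :=
    (integrable_const 1).indicator (hbox J)
  simp only [hexpand]
  rw [integral_finsetSum _ fun J _ => (hintegrable J).mul_const _, Complex.ofReal_sum]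
  refine Finset.sum_congr rfl fun J _ => ?_
  rw [integral_mul_const, integral_indicator (hbox J), Finset.prod_neg, mul_left_comm]
  simp

end Correlations

section Decoupling

variable {X : Type*} {ι : Type*} [DecidableEq ι] {Y : ι → Type*}

/-- The map which keeps the coordinates in `J` of the first point of `∏ᵢ Yᵢ` and takes the
remaining ones from the second. -/
def mixCoordinates (J : Finset ι) (q : (X × ∀ i, Y i) × ∀ i, Y i) : X × ∀ i, Y i :=
  (q.1.1, fun i => if i ∈ J then q.1.2 i else q.2 i)

theorem preimage_mixCoordinates_box [Fintype ι] (J : Finset ι) (B : Set X)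
    (A : ∀ i, Set (Y i)) :
    mixCoordinates J ⁻¹' (B ×ˢ Set.univ.pi A) =
      (B ×ˢ (J : Set ι).pi A) ×ˢ ((Jᶜ : Finset ι) : Set ι).pi A := by
  ext ⟨⟨x, y⟩, z⟩
  have hmix : (∀ i, (if i ∈ J then y i else z i) ∈ A i) ↔
      (∀ i ∈ J, y i ∈ A i) ∧ ∀ i ∉ J, z i ∈ A i := by
    rw [← forall_and]
    refine forall_congr' fun i => ?_
    by_cases hi : i ∈ J <;> simp [hi]
  simp [mixCoordinates, hmix, and_assoc]

variable [MeasurableSpace X] [∀ i, MeasurableSpace (Y i)]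

theorem measurable_mixCoordinates (J : Finset ι) :
    Measurable (mixCoordinates (X := X) (Y := Y) J) := by
  refine measurable_fst.fst.prodMk (measurable_pi_lambda _ fun i => ?_)
  by_cases hi : i ∈ J
  · simpa only [hi, if_true] using measurable_fst.snd.eval
  · simpa only [hi, if_false] using measurable_snd.eval

variable [Fintype ι]

/-- The measure obtained from `lam` by replacing the coordinates outside `J` by independent ones
with distributions `ν i`. -/
noncomputable def decouple (lam : Measure (X × ∀ i, Y i)) (ν : ∀ i, Measure (Y i)) (J : Finset ι) :
    Measure (X × ∀ i, Y i) :=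
  (lam.prod (Measure.pi ν)).map (mixCoordinates J)

variable {lam : Measure (X × ∀ i, Y i)} {ν : ∀ i, Measure (Y i)} [∀ i, IsProbabilityMeasure (ν i)]

theorem decouple_univ [SFinite lam] : decouple lam ν Finset.univ = lam := by
  have hmix : mixCoordinates (X := X) (Y := Y) Finset.univ = Prod.fst := by
    ext q <;> simp [mixCoordinates]
  rw [decouple, hmix, Measure.map_fst_prod, measure_univ, one_smul]

instance [IsProbabilityMeasure lam] (J : Finset ι) : IsProbabilityMeasure (decouple lam ν J) :=
  Measure.isProbabilityMeasure_map (measurable_mixCoordinates J).aemeasurable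

theorem measureReal_decouple_box [SFinite lam] (J : Finset ι) {B : Set X} (hB : MeasurableSet B)
    {A : ∀ i, Set (Y i)} (hA : ∀ i, MeasurableSet (A i)) :
    (decouple lam ν J).real (B ×ˢ Set.univ.pi A) =
      lam.real (B ×ˢ (J : Set ι).pi A) * ∏ i ∈ Jᶜ, (ν i).real (A i) := by
  rw [Measure.real, decouple, Measure.map_apply (measurable_mixCoordinates J)
    (hB.prod (MeasurableSet.univ_pi hA)), preimage_mixCoordinates_box, Measure.prod_prod,
    Measure.pi_pi_finset, ENNReal.toReal_mul, ENNReal.toReal_prod]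
  rfl

variable [IsProbabilityMeasure lam]

theorem ergodic_decouple {T : X ≃ᵐ X} {S : ∀ i, Y i ≃ᵐ Y i}
    (hS : ∀ i, IsWeaklyMixing (ν i) (S i))
    (hlam : Ergodic (T.prodCongr (MeasurableEquiv.piCongrRight S)) lam) (J : Finset ι) :
    Ergodic (T.prodCongr (MeasurableEquiv.piCongrRight S)) (decouple lam ν J) := by
  refine MeasurePreserving.ergodic_of_ergodic_semiconj (g := mixCoordinates J)
    ⟨measurable_mixCoordinates J, rfl⟩ (ergodic_prodMap_piMap hlam hS)
    (MeasurableEquiv.measurable _) ?_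
  rintro ⟨⟨x, y⟩, z⟩
  exact Prod.ext rfl (funext fun i => (apply_ite (S i) (i ∈ J) (y i) (z i)).symm)

theorem sum_powerset_measureReal_decouple_box (I : Finset ι) {B : Set X} (hB : MeasurableSet B)
    {A : ∀ i, Set (Y i)} (hA : ∀ i, MeasurableSet (A i)) :
    ((∑ J ∈ I.powerset, (-1) ^ (I \ J).card * (decouple lam ν J).real (B ×ˢ Set.univ.pi A) : ℝ) : ℂ)
      = (∫ p, B.indicator 1 p.1 * ∏ i ∈ I, centeredIndicator (ν i) (A i) (p.2 i) ∂lam) *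
        (∏ i ∈ Iᶜ, (ν i).real (A i) : ℝ) := by
  rw [integral_indicator_mul_prod_centeredIndicator I hB hA, ← Complex.ofReal_mul, Finset.sum_mul]
  refine congrArg _ (Finset.sum_congr rfl fun J hJ => ?_)
  have hcompl : Jᶜ \ Iᶜ = I \ J := compl_sdiff_compl
  rw [measureReal_decouple_box J hB hA, mul_assoc, mul_assoc, ← hcompl,
    Finset.prod_sdiff (Finset.compl_subset_compl.2 (Finset.mem_powerset.1 hJ))]

theorem sum_powerset_measureReal_decouple_eq_zero {I : Finset ι}
    (h : ∀ B : Set X, MeasurableSet B → ∀ A : ∀ i, Set (Y i), (∀ i, MeasurableSet (A i)) →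
      ∫ p, B.indicator 1 p.1 * ∏ i ∈ I, centeredIndicator (ν i) (A i) (p.2 i) ∂lam = 0)
    {s : Set (X × ∀ i, Y i)} (hs : MeasurableSet s) :
    ∑ J ∈ I.powerset, (-1) ^ (I \ J).card * (decouple lam ν J).real s = 0 := by
  let κ : SignedMeasure (X × ∀ i, Y i) :=
    ∑ J ∈ I.powerset, (-1 : ℝ) ^ (I \ J).card • (decouple lam ν J).toSignedMeasure
  have hκ {t : Set (X × ∀ i, Y i)} (ht : MeasurableSet t) :
      κ t = ∑ J ∈ I.powerset, (-1) ^ (I \ J).card * (decouple lam ν J).real t := by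
    simp [κ, Measure.toSignedMeasure_apply_measurable ht]
  have hbox (t : Set (X × ∀ i, Y i)) (ht : t ∈ measurableBoxes X Y) : κ t = 0 := by
    obtain ⟨B, A, hB, hA, rfl⟩ := exists_eq_of_mem_measurableBoxes ht
    rw [hκ (hB.prod (MeasurableSet.univ_pi hA))]
    refine Complex.ofReal_injective ((sum_powerset_measureReal_decouple_box I hB hA).trans ?_)
    rw [h B hB A hA, zero_mul, Complex.ofReal_zero]
  have hzero : κ = 0 :=
    VectorMeasure.ext_of_generateFrom _ hbox generateFrom_measurableBoxes.symm
      isPiSystem_measurableBoxes (hbox _ univ_mem_measurableBoxes)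
  rw [← hκ hs, hzero]
  rfl

theorem decouple_absolutelyContinuous_sum_ssubsets {I : Finset ι}
    (h : ∀ B : Set X, MeasurableSet B → ∀ A : ∀ i, Set (Y i), (∀ i, MeasurableSet (A i)) →
      ∫ p, B.indicator 1 p.1 * ∏ i ∈ I, centeredIndicator (ν i) (A i) (p.2 i) ∂lam = 0) :
    decouple lam ν I ≪ Measure.sum fun J : {J // J ∈ I.ssubsets} => decouple lam ν J := by
  refine Measure.AbsolutelyContinuous.mk fun s hs h0 => ?_
  rw [Measure.sum_apply_eq_zero] at h0
  have hsum := sum_powerset_measureReal_decouple_eq_zero h hs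
  rw [← Finset.add_sum_erase _ _ (Finset.mem_powerset_self I), ← Finset.ssubsets,
    Finset.sum_eq_zero fun J hJ => by simp [Measure.real, h0 ⟨J, hJ⟩]] at hsum
  simpa [Measure.real, ENNReal.toReal_eq_zero_iff] using hsum

theorem exists_card_lt_and_decouple_eq {T : X ≃ᵐ X} {S : ∀ i, Y i ≃ᵐ Y i}
    (hS : ∀ i, IsWeaklyMixing (ν i) (S i))
    (hlam : Ergodic (T.prodCongr (MeasurableEquiv.piCongrRight S)) lam) {n : ℕ}
    (h : ∀ I : Finset ι, n ≤ I.card → ∀ B : Set X, MeasurableSet B → ∀ A : ∀ i, Set (Y i),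
      (∀ i, MeasurableSet (A i)) →
      ∫ p, B.indicator 1 p.1 * ∏ i ∈ I, centeredIndicator (ν i) (A i) (p.2 i) ∂lam = 0) :
    ∃ J : Finset ι, J.card < n ∧ decouple lam ν J = lam := by
  obtain ⟨I, hI⟩ := exists_minimal_of_wellFoundedLT (fun I => decouple lam ν I = lam)
    ⟨Finset.univ, decouple_univ⟩
  refine ⟨I, ?_, hI.prop⟩
  by_contra! hcard
  have hsing (J : {J // J ∈ I.ssubsets}) : lam.MutuallySingular (decouple lam ν J) :=
    (eq_or_mutuallySingular_of_ergodic hlam (ergodic_decouple hS hlam J)).resolve_left fun heq =>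
      hI.not_prop_of_lt (Finset.mem_ssubsets.1 J.2) heq.symm
  have hac := decouple_absolutelyContinuous_sum_ssubsets (h I hcard)
  rw [hI.prop] at hac
  exact IsProbabilityMeasure.ne_zero lam ((Measure.MutuallySingular.self_iff lam).1
    ((Measure.MutuallySingular.sum_right.2 hsing).mono_ac .rfl hac))

end Decoupling

section Splitting

variable {X : Type*} [MeasurableSpace X] {ι : Type*} [DecidableEq ι] [Fintype ι]
  {Y : ι → Type*} [∀ i, MeasurableSpace (Y i)] {lam : Measure (X × ∀ i, Y i)} [SFinite lam]
  {ν : ∀ i, Measure (Y i)} [∀ i, IsProbabilityMeasure (ν i)] {I J : Finset ι}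

theorem exists_map_eq_prod_of_decouple_eq (hJI : J ⊆ I) (h : decouple lam ν J = lam) :
    ∃ τ : Measure (X × ∀ i : {i // i ∈ I}, Y i), SFinite τ ∧
      lam.map (fun p => ((p.1, fun i : {i // i ∈ I} => p.2 i), fun j : {j // j ∉ I} => p.2 j)) =
        τ.prod (Measure.pi fun j : {j // j ∉ I} => ν j) := by
  let mixI (q : (X × ∀ i, Y i) × ∀ i : {i // i ∈ I}, Y i) : X × ∀ i : {i // i ∈ I}, Y i :=
    (q.1.1, fun i => if (i : ι) ∈ J then q.1.2 i else q.2 i)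
  have hmixI : Measurable mixI := by
    refine measurable_fst.fst.prodMk (measurable_pi_lambda _ fun i => ?_)
    by_cases hi : (i : ι) ∈ J
    · simpa only [hi, if_true] using measurable_fst.snd.eval
    · simpa only [hi, if_false] using measurable_snd.eval
  have hsplit := ((MeasurePreserving.mk hmixI rfl).prod (.id _)).comp <|
    ((measurePreserving_prodAssoc _ _ _).symm).comp <|
    (MeasurePreserving.id lam).prod (measurePreserving_piEquivPiSubtypeProd ν (· ∈ I))
  refine ⟨_, inferInstance, .trans ?_ hsplit.map_eq⟩
  conv_lhs => rw [← h, decouple, Measure.map_map (by fun_prop) (measurable_mixCoordinates J)]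
  congr 1
  refine funext fun q => Prod.ext rfl (funext fun j => ?_)
  exact if_neg fun hj => j.2 (hJI hj)

theorem map_eq_prod_of_decouple_eq (hJI : J ⊆ I) (h : decouple lam ν J = lam) :
    lam.map (fun p => ((p.1, fun i : {i // i ∈ I} => p.2 i), fun j : {j // j ∉ I} => p.2 j)) =
      (lam.map fun p => (p.1, fun i : {i // i ∈ I} => p.2 i)).prod
        (Measure.pi fun j : {j // j ∉ I} => ν j) := by
  obtain ⟨τ, _, hτ⟩ := exists_map_eq_prod_of_decouple_eq hJI h
  have hfst := congrArg Measure.fst hτ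
  rw [Measure.fst_map_prodMk (by fun_prop), Measure.fst_prod] at hfst
  rw [hτ, hfst]

end Splitting

theorem mainTheorem1_general {X : Type*} [MeasurableSpace X] {μ : Measure X} {T : X ≃ᵐ X}
    {hT : MeasurePreserving T μ μ} {n : ℕ} (hCS : HasCS (n + 1) μ T hT) {ι : Type*} [Fintype ι]
    [DecidableEq ι] (hn : n ≤ Fintype.card ι) {Y : ι → Type*} [∀ i, MeasurableSpace (Y i)]
    {ν : ∀ i, Measure (Y i)} [∀ i, IsProbabilityMeasure (ν i)] {S : ∀ i, Y i ≃ᵐ Y i}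
    (hS : ∀ i, IsWeaklyMixing (ν i) (S i)) {lam : Measure (X × ∀ i, Y i)}
    (hlam : IsErgodicJoining μ T (Measure.pi ν) (MeasurableEquiv.piCongrRight S) lam) :
    ∃ I : Finset ι, I.card = n ∧
      lam.map (fun p => ((p.1, fun i : {i // i ∈ I} => p.2 i), fun j : {j // j ∉ I} => p.2 j)) =
        (lam.map fun p => (p.1, fun i : {i // i ∈ I} => p.2 i)).prod
          (Measure.pi fun j : {j // j ∉ I} => ν j) := by
  have : IsProbabilityMeasure lam := hlam.isProbabilityMeasure
  have : IsProbabilityMeasure μ := hlam.1 ▸ Measure.isProbabilityMeasure_map (by fun_prop)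
  obtain ⟨J, hJcard, hJ⟩ := exists_card_lt_and_decouple_eq hS hlam.2.2 fun I hI B hB A hA =>
    hCS.integral_prod_centeredIndicator_eq_zero n.succ_pos hS hlam hI hA
      (memLp_indicator_const 2 hB 1 (Or.inr (measure_ne_top μ B)))
  obtain ⟨I, hJI, hI⟩ := Finset.exists_superset_card_eq (Nat.lt_succ_iff.1 hJcard) hn
  exact ⟨I, hI, map_eq_prod_of_decouple_eq hJI hJ⟩

theorem mainTheorem1 {X : Type u} [MeasurableSpace X] [StandardBorelSpace X]
    (μ : Measure X) [IsProbabilityMeasure μ] (T : X ≃ᵐ X) (hT : Ergodic T μ)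
    (n : ℕ) (hn : 2 ≤ n) (hCS : HasCS n μ T hT.toMeasurePreserving) :
    HasJP.{u, v} (n - 1) μ T := by
  rintro k hk Y _ _ ν _ S hS lam hlam
  obtain ⟨m, rfl⟩ : ∃ m, n = m + 1 := ⟨n - 1, by omega⟩
  exact mainTheorem1_general hCS (by rw [Fintype.card_fin]; omega) hS hlam
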